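/- Let $n\ge 3$ and let $S(x,y)=\sum_{k=0}^{n}a_kx^{n-k}y^k$ be a real homogeneous polynomial of degree $n$ in two variables whose mixed second derivative is $$S''_{xy}(x,y)=c\,y^{\beta}(y-\alpha x)^{n-2-\beta},$$ where $\beta$ is an integer with $0<\beta<n-2$ and $c,\alpha$ are nonzero real numbers. Put $$D(x,y)=x\,(y-\alpha x)^{n-3-\beta},\qquad a_\beta=\frac{1}{2(\beta+1)}\cdot\frac{n-2(\beta+1)}{n-\beta-2},$$ and for $z\in\mathbb C$ with $\Re z=a_\beta$ and $f\in C_0^\infty(\mathbb R)$ define $$Wf(x)=\int_{-\infty}^{\infty}e^{iS(x,y)}|D(x,y)|^{z}f(y)\,dy .$$ The integral converges absolutely for almost every $x$. Moreover, there is a constant $A$, independent of $z$ and $f$, such that for every $z$ with $\Re z=a_\beta$ the operator $W$ extends from $C_0^\infty(\mathbb R)$ to a bounded operator on $L^2(\mathbb R)$ with $$\|W\|_{L^2\to L^2}\le A\,(1+|\Im z|)^2 .$$ The assertion fails for $\beta=0$: for every $n\ge 3$ the polynomial $S(x,y)=(x-y)^n$ is homogeneous of degree $n$, its mixed derivative is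 $c\,(y-x)^{n-2}$ for some $c\ne0$, $a_0=\tfrac12$, and the operator $$Wf(x)=\int_{-\infty}^{\infty}e^{i(x-y)^n}\,|x(y-x)^{n-3}|^{1/2}f(y)\,dy,\qquad f\in C_0^\infty(\mathbb R),$$ does not extend to a bounded operator on $L^2(\mathbb R)$. -/

import Mathlib

open MeasureTheory MvPolynomial
open scoped ContDiff

/-- The mixed second derivative `S''_{xy}` of the polynomial `S` is `c y^β (y - α x)^(n-2-β)`.
The variable `x` is `X 0` and the variable `y` is `X 1`. -/
def HasHessian (S : MvPolynomial (Fin 2) ℝ) (n β : ℕ) (c α : ℝ) : Prop :=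
  pderiv 0 (pderiv 1 S) = C c * X 1 ^ β * (X 1 - C α * X 0) ^ (n - 2 - β)

/-- The damping factor `D(x, y) = x (y - α x)^(n-3-β)` (used only when `β + 3 ≤ n`). -/
def dampingFactor (n β : ℕ) (α x y : ℝ) : ℝ :=
  x * (y - α * x) ^ (n - 3 - β)

/-- The critical damping exponent `a_β` (used only when `β < n - 2`). -/
noncomputable def criticalExponent (n β : ℕ) : ℝ :=
  1 / (2 * ((β : ℝ) + 1)) * (((n : ℝ) - 2 * ((β : ℝ) + 1)) / ((n : ℝ) - (β : ℝ) - 2))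

/-- The kernel `e^{i S(x, y)} |D(x, y)|^z`. -/
noncomputable def dampedKernel (S : MvPolynomial (Fin 2) ℝ) (D : ℝ → ℝ → ℝ) (z : ℂ)
    (x y : ℝ) : ℂ :=
  Complex.exp (Complex.I * ((eval ![x, y] S : ℝ) : ℂ)) * ((|D x y| : ℝ) : ℂ) ^ z

/-- The damped oscillatory integral `W f (x) = ∫ e^{i S(x, y)} |D(x, y)|^z f(y) dy`. -/
noncomputable def dampedOp (S : MvPolynomial (Fin 2) ℝ) (D : ℝ → ℝ → ℝ) (z : ℂ)
    (f : ℝ → ℂ) (x : ℝ) : ℂ :=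
  ∫ y, dampedKernel S D z x y * f y

/-- The bounded operator `T` on `L²(ℝ)` extends `W`, which is given on `C_0^∞(ℝ)` by the
integral. -/
def ExtendsDampedOp (S : MvPolynomial (Fin 2) ℝ) (D : ℝ → ℝ → ℝ) (z : ℂ)
    (T : Lp ℂ 2 (volume : Measure ℝ) →L[ℂ] Lp ℂ 2 (volume : Measure ℝ)) : Prop :=
  ∀ (f : ℝ → ℂ) (hf : ContDiff ℝ ∞ f) (hc : HasCompactSupport f),
    T ((hf.continuous.memLp_of_hasCompactSupport (p := 2) (μ := volume) hc).toLp f)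
      =ᵐ[volume] dampedOp S D z f

/-!
# Critical damping for degenerate oscillatory integrals with a homogeneous polynomial phase

Write `m = n - 2 - β ≥ 1`. After the substitution `u = α x` the phase `P (u, y)` has mixed
derivative `c' y ^ β (y - u) ^ m`, and away from the null set `u (y - u) = 0` the kernel is a
constant multiple of `exp (i P + z (log |u| + (m - 1) log |y - u|))`; see `IsMixedPhase`,
`logKernel` and `dampedOp_eq_integral_logKernel`.

**One box.** The plane is cut, up to a null set, into boxes `|u| ~ 2 ^ j`, `|y| ~ 2 ^ k`,
`|y - u| ~ 2 ^ l` with fixed signs. On a box the mixed derivative has a fixed sign and constant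
size, so the Gram kernel `∫ conj (K (u, y₁)) K (u, y₂) du` is an oscillatory integral whose phase
`φ` satisfies `|φ'| ≳ 2 ^ (k β + l m) |y₁ - y₂|` by the mean value theorem in `y`. Cauchy's mean
value theorem gives `|φ''| ≲ 2 ^ (-l) |φ'|` as well, and one integration by parts bounds the Gram
kernel by a multiple of `1 / |φ'|`. Interpolating this with the trivial bound to the power
`|y₁ - y₂| ^ (-3 / 4)` costs nothing at the critical scale and keeps the kernel integrable; Schur's
test then bounds the square of the norm of the box operator by `C (1 + |z|) 2 ^ Q`, where `Q` is
`boxExponent` (`IsMixedPhase.box_estimate`).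

**The exponents.** For the critical damping, with `X` the integer `phaseSize` (so that `2 ^ X` is
the size of the phase on the box), one has the identity
`Q = X / (β + 1) - (3 / 4) max 0 X + 2 a (j - l) - (β / (β + 1)) ((k - l)₊ + (l - j)₊)`.
If `β ≥ 1`, the first two terms decay in `|X|`, because `1 / (β + 1) < 3 / 4`, and the others decay
in `|j - l|` on nonempty boxes (`critical_exponent_balance`). Since `X` is strictly increasing in
`k`, and in `l` for fixed `j - l`, the bounds are summable over the boxes meeting a given row or a
given column (`tsum_row_weight_le`, `tsum_col_weight_le`). A Schur test for blocks
(`lintegral_sq_le_of_blocks`) adds up the boxes.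

**Failure for `β = 0`.** For `S = (x - y) ^ n` the kernel is `|x| ^ (1 / 2) κ (x - y)` with `κ`
continuous and nonzero. For a suitable test function `f` the squared `L²` norm of the image of
`f (y - h)` grows at least linearly in `h`, so the operator is not bounded.
-/

section Estimates

open scoped ENNReal

/-! ### Oscillatory integrals in one variable -/

/-- A van der Corput estimate for `∫ exp (i φ + Λ)` by a single integration by parts. The hypothesis
`|φ''| ≤ M |φ'|` replaces the usual monotonicity of `φ'`. The complex function `Λ` is the logarithm
of the amplitude. -/
theorem norm_integral_exp_phase_le {p q : ℝ} (hpq : p ≤ q) {φ φ₁ φ₂ : ℝ → ℝ} {Λ Λ₁ : ℝ → ℂ}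
    {B lam M M₁ : ℝ}
    (hφ : ∀ x ∈ Set.Icc p q, HasDerivAt φ (φ₁ x) x)
    (hφ₁ : ∀ x ∈ Set.Icc p q, HasDerivAt φ₁ (φ₂ x) x)
    (hΛ : ∀ x ∈ Set.Icc p q, HasDerivAt Λ (Λ₁ x) x)
    (hφ₂c : ContinuousOn φ₂ (Set.Icc p q)) (hΛ₁c : ContinuousOn Λ₁ (Set.Icc p q))
    (hlam : 0 < lam) (h1 : ∀ x ∈ Set.Icc p q, lam ≤ |φ₁ x|)
    (h2 : ∀ x ∈ Set.Icc p q, |φ₂ x| ≤ M * |φ₁ x|)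
    (h3 : ∀ x ∈ Set.Icc p q, ‖Λ₁ x‖ ≤ M₁)
    (hB : ∀ x ∈ Set.Icc p q, ‖Complex.exp (Λ x)‖ ≤ B) :
    ‖∫ x in p..q, Complex.exp (Complex.I * φ x + Λ x)‖ ≤ B / lam * (2 + (q - p) * (M + M₁)) := by
  have hp : p ∈ Set.Icc p q := Set.left_mem_Icc.2 hpq
  have hq : q ∈ Set.Icc p q := Set.right_mem_Icc.2 hpq
  have hB0 : 0 ≤ B := (norm_nonneg _).trans (hB p hp)
  have hM₁0 : 0 ≤ M₁ := (norm_nonneg _).trans (h3 p hp)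
  have hne : ∀ x ∈ Set.Icc p q, (φ₁ x : ℂ) ≠ 0 := fun x hx h ↦ by
    have := h1 x hx
    rw [Complex.ofReal_eq_zero.1 h, abs_zero] at this
    linarith
  set e : ℝ → ℂ := fun x ↦ Complex.exp (Complex.I * φ x + Λ x) with he
  have hen : ∀ x ∈ Set.Icc p q, ‖e x‖ ≤ B := fun x hx ↦ by
    have : ‖Complex.exp (Complex.I * φ x)‖ = 1 := by
      rw [mul_comm]; exact Complex.norm_exp_ofReal_mul_I _
    rw [he]; simp only
    rw [Complex.exp_add, norm_mul, this, one_mul]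
    exact hB x hx
  -- `R` is the error in `(e / (i φ'))' = e + R`.
  set R : ℝ → ℂ := fun x ↦ e x * (Λ₁ x / (Complex.I * φ₁ x)
    - Complex.I * φ₂ x / (Complex.I * φ₁ x) ^ 2) with hR
  have hed : ∀ x ∈ Set.Icc p q, HasDerivAt e (e x * (Complex.I * φ₁ x + Λ₁ x)) x := fun x hx ↦
    (((hφ x hx).ofReal_comp.const_mul Complex.I).add (hΛ x hx)).cexp
  have hE : ∀ x ∈ Set.Icc p q,
      HasDerivAt (fun x ↦ e x / (Complex.I * φ₁ x)) (e x + R x) x := fun x hx ↦ by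
    have hne' : Complex.I * (φ₁ x : ℂ) ≠ 0 := mul_ne_zero Complex.I_ne_zero (hne x hx)
    refine ((hed x hx).div ((hφ₁ x hx).ofReal_comp.const_mul Complex.I) hne').congr_deriv ?_
    have := hne x hx
    simp only [hR]
    field_simp
    ring
  have hec : ContinuousOn e (Set.Icc p q) := fun x hx ↦ (hed x hx).continuousAt.continuousWithinAt
  have hφ₁c : ContinuousOn (fun x ↦ (φ₁ x : ℂ)) (Set.Icc p q) := fun x hx ↦
    (hφ₁ x hx).ofReal_comp.continuousAt.continuousWithinAt
  have hφ₂c' : ContinuousOn (fun x ↦ (φ₂ x : ℂ)) (Set.Icc p q) :=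
    Complex.continuous_ofReal.comp_continuousOn hφ₂c
  have hRc : ContinuousOn R (Set.Icc p q) := by
    refine hec.mul ((hΛ₁c.div (continuousOn_const.mul hφ₁c) fun x hx ↦ ?_).sub
      ((continuousOn_const.mul hφ₂c').div ((continuousOn_const.mul hφ₁c).pow 2) fun x hx ↦ ?_))
    · exact mul_ne_zero Complex.I_ne_zero (hne x hx)
    · exact pow_ne_zero 2 (mul_ne_zero Complex.I_ne_zero (hne x hx))
  have hei := hec.intervalIntegrable_of_Icc (μ := volume) hpq
  have hRi := hRc.intervalIntegrable_of_Icc (μ := volume) hpq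
  have hFTC := intervalIntegral.integral_eq_sub_of_hasDerivAt
    (f := fun x ↦ e x / (Complex.I * φ₁ x)) (f' := fun x ↦ e x + R x) (a := p) (b := q)
    (by rw [Set.uIcc_of_le hpq]; exact hE) (hei.add hRi)
  rw [intervalIntegral.integral_add hei hRi] at hFTC
  have hbd : ∀ x ∈ Set.Icc p q, ‖e x / (Complex.I * φ₁ x)‖ ≤ B / lam := fun x hx ↦ by
    rw [norm_div, norm_mul, Complex.norm_I, one_mul, Complex.norm_real, Real.norm_eq_abs]
    exact div_le_div₀ hB0 (hen x hx) hlam (h1 x hx)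
  have hRb : ∀ x ∈ Set.uIoc p q, ‖R x‖ ≤ B / lam * (M + M₁) := fun x hx ↦ by
    rw [Set.uIoc_of_le hpq] at hx
    have hx := Set.Ioc_subset_Icc_self hx
    have hpos : 0 < |φ₁ x| := hlam.trans_le (h1 x hx)
    have hA : ‖Λ₁ x / (Complex.I * φ₁ x)‖ ≤ M₁ / lam := by
      rw [norm_div, norm_mul, Complex.norm_I, one_mul, Complex.norm_real, Real.norm_eq_abs]
      exact div_le_div₀ hM₁0 (h3 x hx) hlam (h1 x hx)
    have hM0 : 0 ≤ M := by
      have := (abs_nonneg _).trans (h2 x hx)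
      exact nonneg_of_mul_nonneg_left this hpos
    have hA' : ‖Complex.I * φ₂ x / (Complex.I * φ₁ x) ^ 2‖ ≤ M / lam := by
      rw [norm_div, norm_mul, norm_pow, norm_mul, Complex.norm_I, one_mul, one_mul,
        Complex.norm_real, Complex.norm_real, Real.norm_eq_abs, Real.norm_eq_abs]
      calc |φ₂ x| / |φ₁ x| ^ 2 ≤ M * |φ₁ x| / |φ₁ x| ^ 2 := by gcongr; exact h2 x hx
        _ = M / |φ₁ x| := by field_simp
        _ ≤ M / lam := div_le_div_of_nonneg_left hM0 hlam (h1 x hx)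
    rw [hR]; simp only; rw [norm_mul]
    calc _ ≤ B * (M₁ / lam + M / lam) :=
          mul_le_mul (hen x hx) ((norm_sub_le _ _).trans (add_le_add hA hA')) (norm_nonneg _) hB0
      _ = _ := by ring
  have hRI := intervalIntegral.norm_integral_le_of_norm_le_const hRb
  rw [abs_of_nonneg (sub_nonneg.2 hpq)] at hRI
  rw [eq_sub_of_add_eq hFTC]
  calc _ ≤ (B / lam + B / lam) + B / lam * (M + M₁) * (q - p) :=
        (norm_sub_le _ _).trans (add_le_add ((norm_sub_le _ _).trans
          (add_le_add (hbd q hq) (hbd p hp))) hRI)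
    _ = _ := by ring

/-! ### The exponents at the critical damping, and their summation -/

/-- The exponent of the box estimate at the critical damping decays geometrically away from
`X = 0`, `j = l`, where `X = k β + l m + min j l + min k l`. The hypothesis on `j` holds for the
boxes that are nonempty. -/
theorem critical_exponent_balance {β m a : ℝ} (hβ : 1 ≤ β) (hm : 1 ≤ m)
    (ha : 2 * a = (m - β) / ((β + 1) * m)) {j k l : ℝ} (hj : j ≤ max k l + 1) :
    2 * a * (j + l * (m - 1)) + (min j l + min k l)
        - 3 / 4 * max 0 (k * β + l * m + (min j l + min k l))
      ≤ 1 - 1 / (2 * (β + 1) * m) * (|k * β + l * m + (min j l + min k l)| + |j - l|) := by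
  set X := k * β + l * m + (min j l + min k l) with hX
  set s := 1 / (β + 1) with hs
  have hs0 : 0 < s := by positivity
  have hs1 : s * (β + 1) = 1 := by rw [hs]; field_simp
  have hs2 : s ≤ 1 / 2 := by nlinarith
  set κ := s / m with hκ
  have hκ1 : κ * m = s := by rw [hκ]; field_simp
  have hκ0 : 0 < κ := by positivity
  have hκs : κ ≤ s := by nlinarith
  have ha' : 2 * a * m = s * (m - β) := by
    rw [ha, hs]; field_simp
  -- Here `β ≥ 1` enters: `s ≤ 1 / 2 < 3 / 4`.
  have hX1 : s * X - 3 / 4 * max 0 X ≤ - (s / 2 * |X|) := by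
    rcases le_total 0 X with h | h
    · rw [max_eq_right h, abs_of_nonneg h]; nlinarith
    · rw [max_eq_left h, abs_of_nonpos h]; nlinarith
  have hb1 : κ ≤ β * s - 2 * a := by
    have : κ * m ≤ (β * s - 2 * a) * m := by
      have : (β * s - 2 * a) * m = s * (m * (β - 1) + β) := by linear_combination -ha'
      rw [this, hκ1]
      nlinarith [mul_nonneg (sub_nonneg.2 hβ) (sub_nonneg.2 hm)]
    exact le_of_mul_le_mul_right this (by linarith)
  have hb2 : κ ≤ β * s + 2 * a := by
    have : κ * m ≤ (β * s + 2 * a) * m := by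
      have : (β * s + 2 * a) * m = s * (β * (m - 1) + m) := by linear_combination ha'
      rw [this, hκ1]
      nlinarith [mul_nonneg (sub_nonneg.2 hβ) (sub_nonneg.2 hm)]
    exact le_of_mul_le_mul_right this (by linarith)
  have hV : 2 * a * (j - l) - β * s * ((k - min k l) + (l - min j l)) ≤ 1 - κ * |j - l| := by
    have hβs : 0 ≤ β * s := by positivity
    have hβs1 : β * s ≤ 1 := by nlinarith
    rcases le_total j l with h | h
    · rw [min_eq_left h, abs_of_nonpos (sub_nonpos.2 h)]
      have : 0 ≤ k - min k l := sub_nonneg.2 (min_le_left _ _)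
      nlinarith [mul_nonneg hβs this, mul_nonneg (sub_nonneg.2 hb2) (sub_nonneg.2 h)]
    · rw [min_eq_right h, abs_of_nonneg (sub_nonneg.2 h)]
      have : j - l - 1 ≤ k - min k l := by
        rcases le_total k l with h' | h'
        · rw [min_eq_left h']; rw [max_eq_right h'] at hj; linarith
        · rw [min_eq_right h']; rw [max_eq_left h'] at hj; linarith
      nlinarith [mul_le_mul_of_nonneg_left this hβs,
        mul_nonneg (sub_nonneg.2 hb1) (sub_nonneg.2 h)]
  -- For the critical `a` the exponent is a function of `X` plus one of `j - l`, `k - l`.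
  have hQ : 2 * a * (j + l * (m - 1)) + (min j l + min k l)
      = s * X + (2 * a * (j - l) - β * s * ((k - min k l) + (l - min j l))) := by
    rw [hX]
    linear_combination l * ha' - (min j l + min k l) * hs1
  have hfin : 1 / (2 * (β + 1) * m) = κ / 2 := by rw [hκ, hs]; field_simp
  rw [hQ, hfin]
  nlinarith [abs_nonneg X, abs_nonneg (j - l), mul_nonneg (sub_nonneg.2 hκs) (abs_nonneg X)]

theorem tsum_int_geometric_ne_top {ε : ℝ} (hε : 0 < ε) :
    ∑' n : ℤ, ENNReal.ofReal ((2 : ℝ) ^ (-(ε * |(n : ℝ)|))) ≠ ⊤ := by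
  have hr0 : (0 : ℝ) ≤ 2 ^ (-ε) := by positivity
  have hr1 : (2 : ℝ) ^ (-ε) < 1 := Real.rpow_lt_one_of_one_lt_of_neg (by norm_num) (by linarith)
  have hs := summable_geometric_of_lt_one hr0 hr1
  have key : ∀ n : ℕ, ((2 : ℝ) ^ (-ε)) ^ n = 2 ^ (-(ε * |(n : ℝ)|)) := fun n ↦ by
    rw [← Real.rpow_natCast, ← Real.rpow_mul (by norm_num), abs_of_nonneg (by positivity)]
    ring_nf
  have hsum : Summable fun n : ℤ ↦ (2 : ℝ) ^ (-(ε * |(n : ℝ)|)) := by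
    refine Summable.of_nat_of_neg ?_ ?_
    · simpa [key] using hs
    · simpa [key] using hs
  exact hsum.tsum_ofReal_ne_top

theorem tsum_tsum_weight_le_of_injective (w : ℤ → ℝ≥0∞) (f : ℤ → ℤ → ℤ)
    (hf : ∀ d, Function.Injective (f d)) :
    ∑' d, ∑' n, w (f d n) * w d ≤ (∑' n, w n) * ∑' n, w n := by
  rw [← ENNReal.tsum_mul_left]
  refine ENNReal.tsum_le_tsum fun d ↦ ?_
  rw [ENNReal.tsum_mul_right]
  exact mul_le_mul_left (ENNReal.tsum_comp_le_tsum_of_injective (hf d) w) _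

/-- The binary logarithm of the size of the phase on the box `|u| ~ 2 ^ j`, `|y| ~ 2 ^ k`,
`|y - u| ~ 2 ^ l`: the mixed derivative has size `2 ^ (k β + l m)` there, and the slices of the box
have lengths at most `2 ^ min j l` in `u` and `2 ^ min k l` in `y`. -/
def phaseSize (β m j k l : ℤ) : ℤ := k * β + l * m + (min j l + min k l)

theorem tsum_row_weight_le {β m : ℤ} (hβ : 1 ≤ β) (w : ℤ → ℝ≥0∞)  (j : ℤ) :
    ∑' k, ∑' l, w (phaseSize β m j k l) * w (j - l) ≤ (∑' n, w n) * ∑' n, w n := by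
  rw [ENNReal.tsum_comm]
  rw [← (Equiv.subLeft j).tsum_eq]
  simp only [Equiv.subLeft_apply, sub_sub_cancel]
  refine tsum_tsum_weight_le_of_injective w _ fun d ↦ StrictMono.injective fun k k' h ↦ ?_
  simp only [phaseSize]
  have : k * β < k' * β := by nlinarith
  have : min k (j - d) ≤ min k' (j - d) := min_le_min_right _ h.le
  linarith

theorem tsum_col_weight_le {β m : ℤ} (hm : 1 ≤ m) (w : ℤ → ℝ≥0∞) (k : ℤ) :
    ∑' j, ∑' l, w (phaseSize β m j k l) * w (j - l) ≤ (∑' n, w n) * ∑' n, w n := by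
  rw [ENNReal.tsum_comm]
  have : ∀ l, ∑' j, w (phaseSize β m j k l) * w (j - l)
      = ∑' d, w (phaseSize β m (d + l) k l) * w d := fun l ↦ by
    rw [← (Equiv.addRight l).tsum_eq]
    simp
  simp only [this]
  rw [ENNReal.tsum_comm]
  refine tsum_tsum_weight_le_of_injective w _ fun d ↦ StrictMono.injective fun l l' h ↦ ?_
  simp only [phaseSize]
  have : l * m < l' * m := by nlinarith
  have : min k l ≤ min k l' := min_le_min_left _ h.le
  have : min (d + l) l ≤ min (d + l') l' := min_le_min (by linarith) h.le
  linarith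

/-! ### A Schur test for blocks -/

/-- The Cauchy–Schwarz inequality `(∑ g)² ≤ (∑ N) (∑ g² / N)`; terms with `N b = 0` are allowed as
long as `g b = 0`. -/
theorem sq_tsum_le_tsum_mul_tsum_sq_div {ι : Type*} (N g : ι → ℝ≥0∞)
    (hN0 : ∀ b, N b = 0 → g b = 0) (hN : ∀ b, N b ≠ ⊤) :
    (∑' b, g b) ^ 2 ≤ (∑' b, N b) * ∑' b, g b ^ 2 / N b := by
  let _ : MeasurableSpace ι := ⊤
  have hpq : (2 : ℝ).HolderConjugate 2 := Real.HolderConjugate.two_two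
  have h := ENNReal.lintegral_mul_le_Lp_mul_Lq (μ := Measure.count) hpq
    (f := fun b ↦ N b ^ (1 / 2 : ℝ)) (g := fun b ↦ (g b ^ 2 / N b) ^ (1 / 2 : ℝ))
    (measurable_from_top.aemeasurable) (measurable_from_top.aemeasurable)
  simp only [lintegral_count, Pi.mul_apply, ← ENNReal.rpow_mul] at h
  norm_num at h
  have hg : ∀ b, g b = N b ^ (1 / 2 : ℝ) * (g b ^ 2 / N b) ^ (1 / 2 : ℝ) := fun b ↦ by
    rw [← ENNReal.mul_rpow_of_nonneg _ _ (by norm_num)]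
    by_cases h0 : N b = 0
    · simp [h0, hN0 b h0]
    · rw [ENNReal.mul_div_cancel h0 (hN b), ← ENNReal.rpow_natCast, ← ENNReal.rpow_mul]
      norm_num
  calc (∑' b, g b) ^ 2
      ≤ ((∑' b, N b) ^ (1 / 2 : ℝ) * (∑' b, g b ^ 2 / N b) ^ (1 / 2 : ℝ)) ^ 2 := by
        gcongr
        refine le_trans (le_of_eq (tsum_congr hg)) h
    _ = _ := by
        rw [mul_pow]
        simp only [← ENNReal.rpow_natCast, ← ENNReal.rpow_mul]
        norm_num

/-- Schur's test for a function that is dominated by a sum of blocks `Fb b`, where the block `b` is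
supported in `I b` and has `L²` norm at most `N b` times that of `f` on `J b`. It suffices that the
sums of `N b` over the blocks with `x ∈ I b`, and over those with `y ∈ J b`, are bounded. -/
theorem lintegral_sq_le_of_blocks {α : Type*} [MeasurableSpace α] {μ : Measure α}
    {ι : Type*} [Countable ι] {F : α → ℂ} {Fb : ι → α → ℂ} {f : α → ℂ}
    (hFb : ∀ b, Measurable (Fb b)) (hf : Measurable f) {N : ι → ℝ≥0∞} {I J : ι → Set α}
    (hI : ∀ b x, x ∉ I b → Fb b x = 0) (hJ : ∀ b, MeasurableSet (J b))
    (hN0 : ∀ b, N b ≠ 0) (hN : ∀ b, N b ≠ ⊤)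
    (hF : ∀ᵐ x ∂μ, ‖F x‖ₑ ≤ ∑' b, ‖Fb b x‖ₑ)
    (hb : ∀ b, ∫⁻ x, ‖Fb b x‖ₑ ^ 2 ∂μ ≤ N b ^ 2 * ∫⁻ y in J b, ‖f y‖ₑ ^ 2 ∂μ)
    {C₁ C₂ : ℝ≥0∞} (h₁ : ∀ x, ∑' b, (I b).indicator (fun _ ↦ N b) x ≤ C₁)
    (h₂ : ∀ y, ∑' b, (J b).indicator (fun _ ↦ N b) y ≤ C₂) :
    ∫⁻ x, ‖F x‖ₑ ^ 2 ∂μ ≤ C₁ * C₂ * ∫⁻ y, ‖f y‖ₑ ^ 2 ∂μ := by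
  have hpt : ∀ᵐ x ∂μ, ‖F x‖ₑ ^ 2 ≤ C₁ * ∑' b, ‖Fb b x‖ₑ ^ 2 / N b := by
    filter_upwards [hF] with x hx
    calc ‖F x‖ₑ ^ 2 ≤ (∑' b, ‖Fb b x‖ₑ) ^ 2 := by gcongr
      _ ≤ (∑' b, (I b).indicator (fun _ ↦ N b) x)
          * ∑' b, ‖Fb b x‖ₑ ^ 2 / (I b).indicator (fun _ ↦ N b) x := by
        refine sq_tsum_le_tsum_mul_tsum_sq_div _ _ (fun b h ↦ ?_) (fun b ↦ ?_)
        · by_cases hxI : x ∈ I b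
          · rw [Set.indicator_of_mem hxI] at h; exact absurd h (hN0 b)
          · simp [hI b x hxI]
        · by_cases hxI : x ∈ I b
          · rw [Set.indicator_of_mem hxI]; exact hN b
          · simp [hxI]
      _ ≤ _ := by
        refine mul_le_mul' (h₁ x) (ENNReal.tsum_le_tsum fun b ↦ ?_)
        by_cases hxI : x ∈ I b
        · rw [Set.indicator_of_mem hxI]
        · simp [hI b x hxI]
  calc ∫⁻ x, ‖F x‖ₑ ^ 2 ∂μ ≤ ∫⁻ x, C₁ * ∑' b, ‖Fb b x‖ₑ ^ 2 / N b ∂μ := lintegral_mono_ae hpt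
    _ = C₁ * ∑' b, (∫⁻ x, ‖Fb b x‖ₑ ^ 2 ∂μ) / N b := by
      have hm : ∀ b, Measurable fun x ↦ ‖Fb b x‖ₑ ^ 2 := fun b ↦ (hFb b).enorm.pow_const 2
      rw [lintegral_const_mul _ (Measurable.tsum fun b ↦ (hm b).div_const _),
        lintegral_tsum fun b ↦ ((hm b).div_const _).aemeasurable]
      simp only [div_eq_mul_inv]
      congr 1
      exact tsum_congr fun b ↦ lintegral_mul_const _ (hm b)
    _ ≤ C₁ * ∑' b, ∫⁻ y, (J b).indicator (fun _ ↦ N b) y * ‖f y‖ₑ ^ 2 ∂μ := by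
      gcongr with b
      refine ENNReal.div_le_of_le_mul ((hb b).trans_eq ?_)
      rw [← lintegral_indicator (hJ b), sq (N b), mul_assoc, mul_comm (N b)]
      congr 1
      rw [← lintegral_const_mul _ ((hf.enorm.pow_const 2).indicator (hJ b))]
      refine lintegral_congr fun y ↦ ?_
      by_cases hy : y ∈ J b <;> simp [hy]
    _ ≤ C₁ * ∫⁻ y, C₂ * ‖f y‖ₑ ^ 2 ∂μ := by
      have hm : ∀ b, Measurable fun y ↦ (J b).indicator (fun _ ↦ N b) y * ‖f y‖ₑ ^ 2 := fun b ↦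
        (measurable_const.indicator (hJ b)).mul (hf.enorm.pow_const 2)
      rw [← lintegral_tsum fun b ↦ (hm b).aemeasurable]
      gcongr with y
      rw [ENNReal.tsum_mul_right]
      gcongr
      exact h₂ y
    _ = _ := by rw [lintegral_const_mul _ (hf.enorm.pow_const 2), mul_assoc]

/-! ### The `T*T` argument -/

theorem ENNReal.two_mul_mul_le_add_sq (a b : ℝ≥0∞) : 2 * (a * b) ≤ a ^ 2 + b ^ 2 := by
  wlog h : a ≤ b generalizing a b
  · rw [mul_comm a b, add_comm]
    exact this b a (le_of_not_ge h)
  obtain ⟨c, rfl⟩ := exists_add_of_le h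
  calc 2 * (a * (a + c)) ≤ 2 * (a * (a + c)) + c ^ 2 := le_self_add
    _ = _ := by ring

/-- Schur's test for a nonnegative even convolution kernel, in quadratic form. -/
theorem lintegral_lintegral_convolution_le {h : ℝ → ℝ≥0∞} (hh : Measurable h)
    {g : ℝ → ℝ≥0∞} (hg : Measurable g) (hge : ∀ t, g (-t) = g t) :
    ∫⁻ x, ∫⁻ y, h x * h y * g (x - y) ≤ (∫⁻ t, g t) * ∫⁻ x, h x ^ 2 := by
  have key : ∀ x y, 2 * (h x * h y * g (x - y))
      ≤ h x ^ 2 * g (x - y) + h y ^ 2 * g (x - y) := fun x y ↦ by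
    rw [← add_mul, ← mul_assoc]
    gcongr
    exact ENNReal.two_mul_mul_le_add_sq _ _
  have h1 : ∫⁻ x, ∫⁻ y, h x ^ 2 * g (x - y) = (∫⁻ t, g t) * ∫⁻ x, h x ^ 2 := by
    rw [mul_comm, ← lintegral_mul_const _ (hh.pow_const 2)]
    refine lintegral_congr fun x ↦ ?_
    rw [lintegral_const_mul _ (by fun_prop),
      lintegral_sub_left_eq_self g x]
  have h2 : ∫⁻ x, ∫⁻ y, h y ^ 2 * g (x - y) = (∫⁻ t, g t) * ∫⁻ x, h x ^ 2 := by
    rw [lintegral_lintegral_swap (by fun_prop)]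
    rw [← h1]
    refine lintegral_congr fun x ↦ lintegral_congr fun y ↦ ?_
    rw [← hge, neg_sub]
  have h3 : 2 * ∫⁻ x, ∫⁻ y, h x * h y * g (x - y)
      ≤ 2 * ((∫⁻ t, g t) * ∫⁻ x, h x ^ 2) := by
    calc _ = ∫⁻ x, ∫⁻ y, 2 * (h x * h y * g (x - y)) := by
          rw [← lintegral_const_mul _ (by fun_prop)]
          refine lintegral_congr fun x ↦ ?_
          rw [← lintegral_const_mul _ (by fun_prop)]
      _ ≤ ∫⁻ x, ∫⁻ y, (h x ^ 2 * g (x - y) + h y ^ 2 * g (x - y)) := by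
          gcongr with x y
          exact key x y
      _ = _ := by
          rw [two_mul]
          nth_rewrite 1 [← h1]
          rw [← h2, ← lintegral_add_left (by fun_prop)]
          refine lintegral_congr fun x ↦ ?_
          rw [lintegral_add_left (by fun_prop)]
  exact (ENNReal.mul_le_mul_iff_right (by norm_num) (by norm_num)).1 h3

/-- If the Gram kernel `∫ conj (k (x, y₁)) k (x, y₂) dx` of a bounded kernel supported in a set of
finite measure is dominated off the diagonal by an even function `g (y₁ - y₂)`, then `∫ g` bounds
the square of the `L²` norm of the operator with kernel `k`. -/
theorem lintegral_sq_integral_le_of_gram {k : ℝ → ℝ → ℂ} (hk : Measurable (Function.uncurry k))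
    {A : ℝ} (hA : ∀ x y, ‖k x y‖ ≤ A) {I J : Set ℝ}
    (hJm : MeasurableSet J) (hI : volume I ≠ ⊤) (hJ : volume J ≠ ⊤)
    (hsupp : ∀ x y, k x y ≠ 0 → x ∈ I ∧ y ∈ J) {f : ℝ → ℂ} (hf : Measurable f) {Mf : ℝ}
    (hMf : ∀ y, ‖f y‖ ≤ Mf) {g : ℝ → ℝ≥0∞} (hg : Measurable g) (hge : ∀ t, g (-t) = g t)
    (hG : ∀ y₁ ∈ J, ∀ y₂ ∈ J, y₁ ≠ y₂ →
      ‖∫ x, (starRingEnd ℂ) (k x y₁) * k x y₂‖ₑ ≤ g (y₁ - y₂)) :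
    ∫⁻ x, ‖∫ y, k x y * f y‖ₑ ^ 2 ≤ (∫⁻ t, g t) * ∫⁻ y in J, ‖f y‖ₑ ^ 2 := by
  have hA0 : 0 ≤ A := (norm_nonneg _).trans (hA 0 0)
  have hMf0 : 0 ≤ Mf := (norm_nonneg _).trans (hMf 0)
  have hkm1 : ∀ x, Measurable (k x) := fun x ↦ hk.comp (measurable_const.prodMk measurable_id)
  set Φ : ℝ → ℝ × ℝ → ℂ := fun x p ↦
    (starRingEnd ℂ) (k x p.1 * f p.1) * (k x p.2 * f p.2) with hΦ
  set h : ℝ → ℂ := fun x ↦ ∫ y, k x y * f y with hh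
  have hΦi : Integrable (Function.uncurry Φ) (volume.prod (volume.prod volume)) := by
    have hfin : (volume.prod (volume.prod volume)) (I ×ˢ (J ×ˢ J)) ≠ ⊤ := by
      rw [Measure.prod_prod, Measure.prod_prod]
      exact ENNReal.mul_ne_top hI (ENNReal.mul_ne_top hJ hJ)
    have hs : Function.support (Function.uncurry Φ) ⊆ I ×ˢ (J ×ˢ J) := by
      rintro ⟨x, y₁, y₂⟩ hne
      simp only [Function.mem_support, Function.uncurry, hΦ, ne_eq, mul_eq_zero, map_eq_zero,
        not_or] at hne
      exact ⟨(hsupp x y₁ hne.1.1).1, (hsupp x y₁ hne.1.1).2, (hsupp x y₂ hne.2.1).2⟩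
    rw [← integrableOn_iff_integrable_of_support_subset hs]
    have hm : Measurable (Function.uncurry Φ) := by
      have h1 : Measurable fun q : ℝ × ℝ × ℝ ↦ k q.1 q.2.1 :=
        hk.comp (measurable_fst.prodMk (measurable_fst.comp measurable_snd))
      have h2 : Measurable fun q : ℝ × ℝ × ℝ ↦ k q.1 q.2.2 :=
        hk.comp (measurable_fst.prodMk (measurable_snd.comp measurable_snd))
      exact (Complex.continuous_conj.measurable.comp
        (h1.mul (hf.comp (measurable_fst.comp measurable_snd)))).mul
        (h2.mul (hf.comp (measurable_snd.comp measurable_snd)))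
    refine IntegrableOn.of_bound (lt_top_iff_ne_top.2 hfin) hm.aestronglyMeasurable
      ((A * Mf) * (A * Mf)) (Filter.Eventually.of_forall ?_)
    rintro ⟨x, y₁, y₂⟩
    simp only [Function.uncurry, hΦ, norm_mul, RCLike.norm_conj]
    gcongr
    exacts [hA _ _, hMf _, hA _ _, hMf _]
  have hhΦ : ∀ x, ((‖h x‖ ^ 2 : ℝ) : ℂ) = ∫ p, Φ x p ∂(volume.prod volume) := fun x ↦ by
    simp only [hΦ]
    rw [integral_prod_mul (fun y ↦ (starRingEnd ℂ) (k x y * f y)) (fun y ↦ k x y * f y),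
      integral_conj, ← Complex.normSq_eq_conj_mul_self, Complex.normSq_eq_norm_sq]
  have hint : Integrable fun x ↦ ‖h x‖ ^ 2 := by
    have := hΦi.integral_prod_left
    simp only [Function.uncurry] at this
    simp only [← hhΦ] at this
    exact this.re
  have h1 : ∫⁻ x, ‖h x‖ₑ ^ 2 = ‖∫ p, (∫ x, Φ x p) ∂(volume.prod volume)‖ₑ := by
    rw [← integral_integral_swap hΦi]
    simp only [← hhΦ]
    rw [integral_complex_ofReal, ← ofReal_norm, Complex.norm_real, Real.norm_eq_abs,
      abs_of_nonneg (integral_nonneg fun x ↦ by positivity),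
      ofReal_integral_eq_lintegral_ofReal hint (Filter.Eventually.of_forall fun x ↦ by positivity)]
    refine lintegral_congr fun x ↦ ?_
    rw [ENNReal.ofReal_pow (norm_nonneg _), ofReal_norm]
  rw [h1]
  set a : ℝ → ℝ≥0∞ := J.indicator fun y ↦ ‖f y‖ₑ with ha
  have ham : Measurable a := hf.enorm.indicator hJm
  have hpt : ∀ p : ℝ × ℝ, p.1 ≠ p.2 → ‖∫ x, Φ x p‖ₑ ≤ a p.1 * a p.2 * g (p.1 - p.2) := by
    rintro ⟨y₁, y₂⟩ hne
    have hfac : ∫ x, Φ x (y₁, y₂) = (starRingEnd ℂ) (f y₁) * f y₂ *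
        ∫ x, (starRingEnd ℂ) (k x y₁) * k x y₂ := by
      rw [← integral_const_mul]
      congr 1 with x
      simp only [hΦ, map_mul]
      ring
    by_cases hy₁ : y₁ ∈ J
    · by_cases hy₂ : y₂ ∈ J
      · rw [hfac, enorm_mul, enorm_mul]
        simp only [ha, Set.indicator_of_mem hy₁, Set.indicator_of_mem hy₂]
        gcongr
        · rw [← ofReal_norm, ← ofReal_norm, RCLike.norm_conj]
        · exact hG y₁ hy₁ y₂ hy₂ hne
      · have : ∀ x, k x y₂ = 0 := fun x ↦ by
          by_contra hc; exact hy₂ (hsupp x y₂ hc).2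
        simp [hΦ, this]
    · have : ∀ x, k x y₁ = 0 := fun x ↦ by
        by_contra hc; exact hy₁ (hsupp x y₁ hc).2
      simp [hΦ, this]
  have hdiag : ∀ᵐ p : ℝ × ℝ ∂(volume.prod volume), p.1 ≠ p.2 := by
    have hms : MeasurableSet {p : ℝ × ℝ | p.1 ≠ p.2} :=
      (measurableSet_eq_fun measurable_fst measurable_snd).compl
    rw [Measure.ae_prod_iff_ae_ae hms]
    refine Filter.Eventually.of_forall fun x ↦ ?_
    filter_upwards [Measure.ae_ne volume x] with y hy using hy.symm
  calc _ ≤ ∫⁻ p, ‖∫ x, Φ x p‖ₑ ∂(volume.prod volume) := enorm_integral_le_lintegral_enorm _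
    _ ≤ ∫⁻ p, a p.1 * a p.2 * g (p.1 - p.2) ∂(volume.prod volume) :=
      lintegral_mono_ae (hdiag.mono hpt)
    _ = ∫⁻ x, ∫⁻ y, a x * a y * g (x - y) :=
      lintegral_prod _ (by fun_prop)
    _ ≤ (∫⁻ t, g t) * ∫⁻ x, a x ^ 2 := lintegral_lintegral_convolution_le ham hg hge
    _ = _ := by
      rw [← lintegral_indicator hJm]
      congr 1
      refine lintegral_congr fun y ↦ ?_
      by_cases hy : y ∈ J <;> simp [ha, hy]

/-! ### The normalised phase and kernel -/

/-- `P` is a phase with mixed derivative `c y ^ β (y - u) ^ m`; `P₁` and `P₂` are its first two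
derivatives in `u`. The derivative of `P₂` in `y` is the derivative in `u` of the mixed
derivative. -/
structure IsMixedPhase (β m : ℕ) (c : ℝ) (P P₁ P₂ : ℝ → ℝ → ℝ) : Prop where
  continuous : Continuous (Function.uncurry P)
  hasDerivAt : ∀ u y, HasDerivAt (fun u ↦ P u y) (P₁ u y) u
  hasDerivAt₁ : ∀ u y, HasDerivAt (fun u ↦ P₁ u y) (P₂ u y) u
  continuous₂ : ∀ y, Continuous fun u ↦ P₂ u y
  mixed : ∀ u y, HasDerivAt (fun y ↦ P₁ u y) (c * y ^ β * (y - u) ^ m) y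
  mixed₂ : ∀ u y, HasDerivAt (fun y ↦ P₂ u y) (-(c * y ^ β * (m * (y - u) ^ (m - 1)))) y

/-- `log |u| + (m - 1) log |y - u|`, the logarithm of the damping factor; `Real.log` takes the
absolute value of its argument by convention. -/
noncomputable def logDamping (m : ℕ) (u y : ℝ) : ℝ :=
  Real.log u + ((m : ℝ) - 1) * Real.log (y - u)

/-- The damped kernel `exp (i P) (|u| |y - u| ^ (m - 1)) ^ z`, written as one exponential. -/
noncomputable def logKernel (P : ℝ → ℝ → ℝ) (m : ℕ) (z : ℂ) (u y : ℝ) : ℂ :=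
  Complex.exp (Complex.I * (P u y : ℂ) + z * (logDamping m u y : ℂ))

/-- The kernel `K` cut off to `u ∈ U`, `y ∈ Y`, `y - u ∈ V`. -/
noncomputable def boxKernel (K : ℝ → ℝ → ℂ) (U Y V : Set ℝ) (u y : ℝ) : ℂ :=
  {p : ℝ × ℝ | p.1 ∈ U ∧ p.2 ∈ Y ∧ p.2 - p.1 ∈ V}.indicator (Function.uncurry K) (u, y)

theorem boxKernel_of_mem {K : ℝ → ℝ → ℂ} {U Y V : Set ℝ} {u y : ℝ} (h : u ∈ U ∧ y ∈ Y ∧ y - u ∈ V) :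
    boxKernel K U Y V u y = K u y :=
  Set.indicator_of_mem (s := {p : ℝ × ℝ | p.1 ∈ U ∧ p.2 ∈ Y ∧ p.2 - p.1 ∈ V}) h _

theorem boxKernel_of_notMem {K : ℝ → ℝ → ℂ} {U Y V : Set ℝ} {u y : ℝ}
    (h : ¬ (u ∈ U ∧ y ∈ Y ∧ y - u ∈ V)) : boxKernel K U Y V u y = 0 :=
  Set.indicator_of_notMem (s := {p : ℝ × ℝ | p.1 ∈ U ∧ p.2 ∈ Y ∧ p.2 - p.1 ∈ V}) h _

theorem measurable_boxKernel {K : ℝ → ℝ → ℂ} (hK : Measurable (Function.uncurry K))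
    {U Y V : Set ℝ} (hU : MeasurableSet U) (hY : MeasurableSet Y) (hV : MeasurableSet V) :
    Measurable (Function.uncurry (boxKernel K U Y V)) := by
  refine hK.indicator ?_
  exact (measurable_fst hU).inter ((measurable_snd hY).inter
    ((measurable_snd.sub measurable_fst) hV))

theorem norm_logKernel (P : ℝ → ℝ → ℝ) (m : ℕ) (z : ℂ) (u y : ℝ) :
    ‖logKernel P m z u y‖ = Real.exp (z.re * logDamping m u y) := by
  rw [logKernel, Complex.norm_exp]
  simp

theorem measurable_logKernel {P : ℝ → ℝ → ℝ} (hP : Continuous (Function.uncurry P)) (m : ℕ)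
    (z : ℂ) : Measurable (Function.uncurry (logKernel P m z)) := by
  have h : Measurable fun p : ℝ × ℝ ↦ P p.1 p.2 := hP.measurable
  simp only [logKernel, logDamping, Function.uncurry_def]
  fun_prop

namespace IsMixedPhase

variable {β m : ℕ} {c : ℝ} {P P₁ P₂ : ℝ → ℝ → ℝ}

/-- The phase `φ = P (·, y₂) - P (·, y₁)` of the Gram kernel satisfies `|φ'| ≳ |y₁ - y₂|` and
`|φ''| ≤ (m / ρ₃) |φ'|`. The second bound is Cauchy's mean value theorem in `y`, as the logarithmic
derivative in `u` of `c y ^ β (y - u) ^ m` is `-m / (y - u)`. -/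
theorem difference_bounds (hP : IsMixedPhase β m c P P₁ P₂) {u y₁ y₂ ρ₂ ρ₃ : ℝ} (hne : y₁ ≠ y₂)
    (hρ₂ : 0 < ρ₂) (hρ₃ : 0 < ρ₃) (hc : c ≠ 0) (hm : 1 ≤ m) (hy : ∀ ξ ∈ Set.uIcc y₁ y₂, ρ₂ ≤ |ξ|)
    (hv : ∀ ξ ∈ Set.uIcc y₁ y₂, ρ₃ ≤ |ξ - u|) :
    |c| * (ρ₂ ^ β * ρ₃ ^ m) * |y₁ - y₂| ≤ |P₁ u y₂ - P₁ u y₁| ∧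
      |P₂ u y₂ - P₂ u y₁| ≤ m / ρ₃ * |P₁ u y₂ - P₁ u y₁| := by
  wlog h : y₁ < y₂ generalizing y₁ y₂
  · have := this hne.symm (by rwa [Set.uIcc_comm]) (by rwa [Set.uIcc_comm])
      (lt_of_le_of_ne (not_lt.1 h) hne.symm)
    rwa [abs_sub_comm y₂, abs_sub_comm (P₁ u y₁), abs_sub_comm (P₂ u y₁)] at this
  rw [Set.uIcc_of_le h.le] at hy hv
  have hc₁ : ContinuousOn (fun y ↦ P₁ u y) (Set.Icc y₁ y₂) := fun y _ ↦
    (hP.mixed u y).continuousAt.continuousWithinAt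
  have hc₂ : ContinuousOn (fun y ↦ P₂ u y) (Set.Icc y₁ y₂) := fun y _ ↦
    (hP.mixed₂ u y).continuousAt.continuousWithinAt
  constructor
  · obtain ⟨ξ, hξ, he⟩ := exists_hasDerivAt_eq_slope _ _ h hc₁ fun y _ ↦ hP.mixed u y
    have hξ' := Set.Ioo_subset_Icc_self hξ
    rw [eq_div_iff (by linarith)] at he
    rw [← he, abs_mul, abs_mul, abs_mul, abs_pow, abs_pow, abs_sub_comm y₁, mul_assoc |c| (|ξ| ^ β)]
    have h1 := hy ξ hξ'
    have h2 := hv ξ hξ'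
    gcongr
  · obtain ⟨ξ, hξ, he⟩ := exists_ratio_hasDerivAt_eq_ratio_slope _ _ h hc₁
      (fun y _ ↦ hP.mixed u y) _ _ hc₂ fun y _ ↦ hP.mixed₂ u y
    have hξ' := Set.Ioo_subset_Icc_self hξ
    have hξ0 : ξ ≠ 0 := abs_pos.1 (hρ₂.trans_le (hy ξ hξ'))
    have hξu : ξ - u ≠ 0 := abs_pos.1 (hρ₃.trans_le (hv ξ hξ'))
    have he' : (P₂ u y₂ - P₂ u y₁) * (ξ - u) = - (m * (P₁ u y₂ - P₁ u y₁)) := by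
      have hcc : c * ξ ^ β * (ξ - u) ^ (m - 1) ≠ 0 := by positivity
      apply mul_right_cancel₀ hcc
      have : (ξ - u) ^ m = (ξ - u) ^ (m - 1) * (ξ - u) := by
        rw [← pow_succ, Nat.sub_add_cancel hm]
      rw [this] at he
      linear_combination he
    have he'' := congrArg abs he'
    rw [abs_mul, abs_neg, abs_mul, Nat.abs_cast] at he''
    rw [div_mul_eq_mul_div, le_div_iff₀ hρ₃, ← he'']
    gcongr
    exact hv ξ hξ'

/-- Bounds for the Gram kernel on a box with `|u| ≥ ρ₁`, `|y| ≥ ρ₂`, `|y - u| ≥ ρ₃`, on which the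
kernel has size at most `A`: the trivial one, the one from oscillation, and its vanishing for
`|y₁ - y₂| ≥ ρ₃`. -/
theorem gram_bound (hP : IsMixedPhase β m c P P₁ P₂) (hc : c ≠ 0) (hm : 1 ≤ m)
    {p₁ p₂ q₁ q₂ w₁ w₂ ρ₁ ρ₂ ρ₃ A : ℝ} {z : ℂ} (hρ₁ : 0 < ρ₁) (hρ₂ : 0 < ρ₂) (hρ₃ : 0 < ρ₃)
    (hU : ∀ u ∈ Set.Icc p₁ p₂, ρ₁ ≤ |u|) (hUl : p₂ - p₁ ≤ ρ₁)
    (hY : ∀ y ∈ Set.Icc q₁ q₂, ρ₂ ≤ |y|)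
    (hV : ∀ v ∈ Set.Icc w₁ w₂, ρ₃ ≤ |v|) (hVl : w₂ - w₁ ≤ ρ₃)
    (hA0 : 0 ≤ A)
    (hA : ∀ u ∈ Set.Icc p₁ p₂, ∀ y, y - u ∈ Set.Icc w₁ w₂ → Real.exp (z.re * logDamping m u y) ≤ A)
    {y₁ y₂ : ℝ} (hy₁ : y₁ ∈ Set.Ioo q₁ q₂) (hy₂ : y₂ ∈ Set.Ioo q₁ q₂) (hne : y₁ ≠ y₂) {G : ℂ}
    (hG : G = ∫ u, (starRingEnd ℂ)
        (boxKernel (logKernel P m z) (Set.Ioo p₁ p₂) (Set.Ioo q₁ q₂) (Set.Ioo w₁ w₂) u y₁) *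
        boxKernel (logKernel P m z) (Set.Ioo p₁ p₂) (Set.Ioo q₁ q₂) (Set.Ioo w₁ w₂) u y₂) :
    ‖G‖ ≤ A ^ 2 * min ρ₁ ρ₃ ∧
    ‖G‖ ≤ A ^ 2 * ((2 + m + 2 * m * ‖z‖) / |c|) / (ρ₂ ^ β * ρ₃ ^ m * |y₁ - y₂|) ∧
    (ρ₃ ≤ |y₁ - y₂| → G = 0) := by
  -- The cut-offs in `u` at `y₁` and `y₂` meet in the interval `(p, q)`, since all three conditions
  -- defining the box are intervals.
  set p := max p₁ (max (y₁ - w₂) (y₂ - w₂)) with hp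
  set q := min p₂ (min (y₁ - w₁) (y₂ - w₁)) with hq
  set φ : ℝ → ℝ := fun u ↦ P u y₂ - P u y₁ with hφ
  set Λ : ℝ → ℂ := fun u ↦ (starRingEnd ℂ) z * (logDamping m u y₁ : ℂ)
    + z * (logDamping m u y₂ : ℂ) with hΛ
  have hG' : G = ∫ u in Set.Ioo p q, Complex.exp (Complex.I * φ u + Λ u) := by
    rw [hG, ← integral_indicator measurableSet_Ioo]
    congr 1 with u
    by_cases hu : u ∈ Set.Ioo p q
    · have hu' := hu
      simp only [hp, hq, Set.mem_Ioo, max_lt_iff, lt_min_iff] at hu'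
      obtain ⟨⟨h1, h2, h3⟩, h4, h5, h6⟩ := hu'
      rw [Set.indicator_of_mem hu, boxKernel_of_mem, boxKernel_of_mem, logKernel, logKernel,
        ← Complex.exp_conj, ← Complex.exp_add]
      · congr 1
        simp only [map_add, map_mul, Complex.conj_I, Complex.conj_ofReal, hφ, hΛ]
        push_cast
        ring
      · exact ⟨⟨h1, h4⟩, hy₂, by constructor <;> linarith⟩
      · exact ⟨⟨h1, h4⟩, hy₁, by constructor <;> linarith⟩
    · rw [Set.indicator_of_notMem hu]
      by_contra hne
      have hne1 := left_ne_zero_of_mul hne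
      have hne2 := right_ne_zero_of_mul hne
      have h1 := not_imp_comm.1 boxKernel_of_notMem (fun h ↦ hne1 (by rw [h, map_zero]))
      have h2 := not_imp_comm.1 boxKernel_of_notMem hne2
      apply hu
      simp only [hp, hq, Set.mem_Ioo, max_lt_iff, lt_min_iff] at h1 h2 ⊢
      obtain ⟨⟨_, _⟩, _, _, _⟩ := h1
      obtain ⟨⟨_, _⟩, _, _, _⟩ := h2
      refine ⟨⟨?_, ?_, ?_⟩, ?_, ?_, ?_⟩ <;> linarith
  have hC0 : 0 ≤ (2 + m + 2 * m * ‖z‖) / |c| := by positivity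
  rcases lt_or_ge q p with hpq | hpq
  · have : G = 0 := by rw [hG', Set.Ioo_eq_empty (not_lt.2 hpq.le)]; simp
    rw [this, norm_zero]
    exact ⟨by positivity, by positivity, fun _ ↦ rfl⟩
  have hmem : ∀ u ∈ Set.Icc p q, u ∈ Set.Icc p₁ p₂ ∧ y₁ - u ∈ Set.Icc w₁ w₂ ∧
      y₂ - u ∈ Set.Icc w₁ w₂ := fun u hu ↦ by
    simp only [hp, hq, Set.mem_Icc, max_le_iff, le_min_iff] at hu ⊢
    obtain ⟨⟨h1, h2, h3⟩, h4, h5, h6⟩ := hu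
    refine ⟨⟨h1, h4⟩, ⟨?_, ?_⟩, ?_, ?_⟩ <;> linarith
  have hu0 : ∀ u ∈ Set.Icc p q, u ≠ 0 := fun u hu ↦
    abs_pos.1 (hρ₁.trans_le (hU u (hmem u hu).1))
  have hv0 : ∀ y, (y = y₁ ∨ y = y₂) → ∀ u ∈ Set.Icc p q, y - u ≠ 0 := fun y hy u hu ↦ by
    rcases hy with rfl | rfl
    · exact abs_pos.1 (hρ₃.trans_le (hV _ (hmem u hu).2.1))
    · exact abs_pos.1 (hρ₃.trans_le (hV _ (hmem u hu).2.2))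
  have hlen1 : q - p ≤ ρ₁ := by
    have := min_le_left p₂ (min (y₁ - w₁) (y₂ - w₁))
    have := le_max_left p₁ (max (y₁ - w₂) (y₂ - w₂))
    linarith
  have hlen3 : q - p ≤ ρ₃ - |y₁ - y₂| := by
    have h1 : q ≤ min (y₁ - w₁) (y₂ - w₁) := min_le_right _ _
    have h2 : max (y₁ - w₂) (y₂ - w₂) ≤ p := le_max_right _ _
    have h3 := min_le_left (y₁ - w₁) (y₂ - w₁)
    have h4 := min_le_right (y₁ - w₁) (y₂ - w₁)
    have h5 := le_max_left (y₁ - w₂) (y₂ - w₂)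
    have h6 := le_max_right (y₁ - w₂) (y₂ - w₂)
    rcases abs_cases (y₁ - y₂) with ⟨h, _⟩ | ⟨h, _⟩ <;> rw [h] <;> linarith
  have hlen3' : q - p ≤ ρ₃ := by linarith [abs_nonneg (y₁ - y₂)]
  have hpq0 : 0 ≤ q - p := sub_nonneg.2 hpq
  have hΛB : ∀ u ∈ Set.Icc p q, ‖Complex.exp (Λ u)‖ ≤ A ^ 2 := fun u hu ↦ by
    obtain ⟨h1, h2, h3⟩ := hmem u hu
    rw [hΛ, Complex.exp_add, norm_mul, Complex.norm_exp, Complex.norm_exp, sq]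
    have e1 : ((starRingEnd ℂ) z * (logDamping m u y₁ : ℂ)).re = z.re * logDamping m u y₁ := by simp
    have e2 : (z * (logDamping m u y₂ : ℂ)).re = z.re * logDamping m u y₂ := by simp
    rw [e1, e2]
    exact mul_le_mul (hA u h1 _ h2) (hA u h1 _ h3) (Real.exp_nonneg _) hA0
  have heq : G = ∫ u in p..q, Complex.exp (Complex.I * φ u + Λ u) := by
    rw [hG', intervalIntegral.integral_of_le hpq, integral_Ioc_eq_integral_Ioo]
  refine ⟨?_, ?_, fun h ↦ ?_⟩
  · have hle : ‖G‖ ≤ A ^ 2 * |q - p| := by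
      rw [heq]
      refine intervalIntegral.norm_integral_le_of_norm_le_const fun u hu ↦ ?_
      rw [Set.uIoc_of_le hpq] at hu
      rw [Complex.exp_add, norm_mul, mul_comm Complex.I, Complex.norm_exp_ofReal_mul_I, one_mul]
      exact hΛB u (Set.Ioc_subset_Icc_self hu)
    refine hle.trans ?_
    rw [abs_of_nonneg hpq0]
    gcongr
    exact le_min hlen1 hlen3'
  · set Λ₁ : ℝ → ℂ := fun u ↦
      (starRingEnd ℂ) z * ((u⁻¹ + ((m : ℝ) - 1) * (-(y₁ - u)⁻¹) : ℝ) : ℂ)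
      + z * ((u⁻¹ + ((m : ℝ) - 1) * (-(y₂ - u)⁻¹) : ℝ) : ℂ) with hΛ₁
    have hL : ∀ y, (y = y₁ ∨ y = y₂) → ∀ u ∈ Set.Icc p q, HasDerivAt (fun u ↦ logDamping m u y)
        (u⁻¹ + ((m : ℝ) - 1) * (-(y - u)⁻¹)) u := fun y hy u hu ↦ by
      refine (Real.hasDerivAt_log (hu0 u hu)).add (HasDerivAt.const_mul _ ?_)
      refine (((hasDerivAt_id u).const_sub y).log (hv0 y hy u hu)).congr_deriv ?_
      simp [neg_div]
    have hinv : ∀ y, (y = y₁ ∨ y = y₂) → ∀ u ∈ Set.Icc p q,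
        |u⁻¹ + ((m : ℝ) - 1) * (-(y - u)⁻¹)| ≤ ρ₁⁻¹ + ((m : ℝ) - 1) * ρ₃⁻¹ := fun y hy u hu ↦ by
      have hm' : (0 : ℝ) ≤ (m : ℝ) - 1 := sub_nonneg.2 (by exact_mod_cast hm)
      refine (abs_add_le _ _).trans (add_le_add ?_ ?_)
      · rw [abs_inv]
        exact inv_anti₀ hρ₁ (hU u (hmem u hu).1)
      · rw [abs_mul, abs_neg, abs_inv, abs_of_nonneg hm']
        gcongr
        rcases hy with rfl | rfl
        · exact hV _ (hmem u hu).2.1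
        · exact hV _ (hmem u hu).2.2
    have hdb : ∀ u ∈ Set.Icc p q, _ := fun u hu ↦
      hP.difference_bounds (u := u) hne hρ₂ hρ₃ hc hm
        (fun ξ hξ ↦ hY ξ (Set.ordConnected_Icc.uIcc_subset (Set.Ioo_subset_Icc_self hy₁)
          (Set.Ioo_subset_Icc_self hy₂) hξ))
        (fun ξ hξ ↦ by
          refine hV (ξ - u) ?_
          obtain ⟨_, ⟨_, _⟩, _, _⟩ := hmem u hu
          have : ξ ∈ Set.Icc (w₁ + u) (w₂ + u) :=
            Set.ordConnected_Icc.uIcc_subset (by constructor <;> linarith)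
              (by constructor <;> linarith) hξ
          constructor <;> linarith [this.1, this.2])
    have hvdc := norm_integral_exp_phase_le hpq (φ := φ) (φ₁ := fun u ↦ P₁ u y₂ - P₁ u y₁)
      (φ₂ := fun u ↦ P₂ u y₂ - P₂ u y₁) (Λ := Λ) (Λ₁ := Λ₁) (B := A ^ 2)
      (lam := |c| * (ρ₂ ^ β * ρ₃ ^ m) * |y₁ - y₂|) (M := m / ρ₃)
      (M₁ := 2 * ‖z‖ * (ρ₁⁻¹ + ((m : ℝ) - 1) * ρ₃⁻¹))
      (fun u _ ↦ (hP.hasDerivAt u y₂).sub (hP.hasDerivAt u y₁))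
      (fun u _ ↦ (hP.hasDerivAt₁ u y₂).sub (hP.hasDerivAt₁ u y₁))
      (fun u hu ↦ ((hL y₁ (Or.inl rfl) u hu).ofReal_comp.const_mul _).add
        ((hL y₂ (Or.inr rfl) u hu).ofReal_comp.const_mul _))
      ((hP.continuous₂ y₂).sub (hP.continuous₂ y₁)).continuousOn
      (by
        have hb : ∀ y, (y = y₁ ∨ y = y₂) → ContinuousOn
            (fun u : ℝ ↦ ((u⁻¹ + ((m : ℝ) - 1) * (-(y - u)⁻¹) : ℝ) : ℂ)) (Set.Icc p q) := fun y hy ↦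
          Complex.continuous_ofReal.comp_continuousOn ((continuousOn_id.inv₀ hu0).add
            (continuousOn_const.mul ((continuousOn_const.sub continuousOn_id).inv₀ (hv0 y hy)).neg))
        exact (continuousOn_const.mul (hb y₁ (Or.inl rfl))).add
          (continuousOn_const.mul (hb y₂ (Or.inr rfl))))
      (by have := abs_pos.2 (sub_ne_zero.2 hne); positivity)
      (fun u hu ↦ (hdb u hu).1) (fun u hu ↦ (hdb u hu).2)
      (fun u hu ↦ by
        have e1 := hinv y₁ (Or.inl rfl) u hu
        have e2 := hinv y₂ (Or.inr rfl) u hu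
        refine (norm_add_le _ _).trans ?_
        rw [norm_mul, norm_mul, RCLike.norm_conj, Complex.norm_real, Complex.norm_real,
          Real.norm_eq_abs, Real.norm_eq_abs, mul_assoc 2, two_mul]
        gcongr)
      hΛB
    rw [heq]
    refine hvdc.trans ?_
    have hm' : (0 : ℝ) ≤ (m : ℝ) - 1 := sub_nonneg.2 (by exact_mod_cast hm)
    have e1 : (q - p) * ρ₁⁻¹ ≤ 1 := by
      rw [← div_eq_mul_inv]; exact (div_le_one hρ₁).2 hlen1
    have e3 : (q - p) * ρ₃⁻¹ ≤ 1 := by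
      rw [← div_eq_mul_inv]; exact (div_le_one hρ₃).2 hlen3'
    have hsum : 2 + (q - p) * (m / ρ₃ + 2 * ‖z‖ * (ρ₁⁻¹ + ((m : ℝ) - 1) * ρ₃⁻¹))
        ≤ 2 + m + 2 * m * ‖z‖ := by
      have : (q - p) * (m / ρ₃ + 2 * ‖z‖ * (ρ₁⁻¹ + ((m : ℝ) - 1) * ρ₃⁻¹))
          = m * ((q - p) * ρ₃⁻¹)
            + 2 * ‖z‖ * ((q - p) * ρ₁⁻¹ + ((m : ℝ) - 1) * ((q - p) * ρ₃⁻¹)) := by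
        rw [div_eq_mul_inv]; ring
      rw [this]
      calc _ ≤ 2 + (m * 1 + 2 * ‖z‖ * (1 + ((m : ℝ) - 1) * 1)) := by gcongr
        _ = _ := by ring
    calc _ ≤ A ^ 2 / (|c| * (ρ₂ ^ β * ρ₃ ^ m) * |y₁ - y₂|) * (2 + m + 2 * m * ‖z‖) := by gcongr
      _ = _ := by
        have := abs_pos.2 (sub_ne_zero.2 hne)
        have := abs_pos.2 hc
        field_simp
  · rw [heq, show q = p by linarith, intervalIntegral.integral_same]

end IsMixedPhase

/-! ### The estimate on one dyadic box -/

theorem lintegral_even_eq_two_mul {g : ℝ → ℝ≥0∞} (hge : ∀ t, g (-t) = g t) :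
    ∫⁻ t, g t = 2 * ∫⁻ t in Set.Ioi 0, g t := by
  have h : ∫⁻ t in Set.Iio 0, g t = ∫⁻ t in Set.Ioi 0, g t := by
    have := (Measure.measurePreserving_neg (volume : Measure ℝ)).setLIntegral_comp_preimage_emb
      (MeasurableEquiv.neg ℝ).measurableEmbedding g (Set.Ioi 0)
    simp only [hge] at this
    simpa using this
  rw [← lintegral_add_compl g (measurableSet_Ioi (a := (0 : ℝ))), Set.compl_Ioi, two_mul,
    setLIntegral_congr Iio_ae_eq_Iic.symm, h]

theorem lintegral_indicator_abs_rpow_le {D ρ : ℝ} (hD : 0 ≤ D) (hρ : 0 < ρ) :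
    ∫⁻ t, (Set.Ioo (-ρ) ρ).indicator (fun t ↦ ENNReal.ofReal (D * |t| ^ (-(3 / 4) : ℝ))) t
      ≤ ENNReal.ofReal (8 * D * ρ ^ (1 / 4 : ℝ)) := by
  rw [lintegral_even_eq_two_mul fun t ↦ by
    have : -t ∈ Set.Ioo (-ρ) ρ ↔ t ∈ Set.Ioo (-ρ) ρ := by
      constructor <;> rintro ⟨_, _⟩ <;> constructor <;> linarith
    simp only [Set.indicator, abs_neg, this]]
  have hi : IntervalIntegrable (fun t : ℝ ↦ D * t ^ (-(3 / 4) : ℝ)) volume 0 ρ :=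
    (intervalIntegral.intervalIntegrable_rpow' (by norm_num)).const_mul D
  rw [intervalIntegrable_iff_integrableOn_Ioc_of_le hρ.le] at hi
  have h1 : ∫⁻ t in Set.Ioi 0,
      (Set.Ioo (-ρ) ρ).indicator (fun t ↦ ENNReal.ofReal (D * |t| ^ (-(3 / 4) : ℝ))) t
      ≤ ∫⁻ t in Set.Ioc 0 ρ, ENNReal.ofReal (D * t ^ (-(3 / 4) : ℝ)) := by
    rw [← lintegral_indicator measurableSet_Ioi, ← lintegral_indicator measurableSet_Ioc]
    refine lintegral_mono fun t ↦ ?_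
    by_cases ht : 0 < t
    · by_cases ht' : t < ρ
      · have : -ρ < t := by linarith
        simp [Set.indicator, ht, ht', ht'.le, abs_of_pos ht, this]
      · simp [Set.indicator, ht']
    · simp [Set.indicator, ht]
  have h2 : ∫⁻ t in Set.Ioc 0 ρ, ENNReal.ofReal (D * t ^ (-(3 / 4) : ℝ))
      = ENNReal.ofReal (D * (4 * ρ ^ (1 / 4 : ℝ))) := by
    rw [← ofReal_integral_eq_lintegral_ofReal hi
      ((ae_restrict_mem measurableSet_Ioc).mono fun t ht ↦ mul_nonneg hD
        (Real.rpow_nonneg ht.1.le _)), ← intervalIntegral.integral_of_le hρ.le,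
      intervalIntegral.integral_const_mul, integral_rpow (Or.inl (by norm_num))]
    congr 2
    norm_num
    ring
  calc _ ≤ 2 * ENNReal.ofReal (D * (4 * ρ ^ (1 / 4 : ℝ))) := by gcongr; exact h1.trans h2.le
    _ = _ := by
      rw [← ENNReal.ofReal_ofNat 2, ← ENNReal.ofReal_mul (by norm_num)]
      congr 1
      ring

/-- The left end of the dyadic interval of size `2 ^ j`, on the positive half-line if `s` is `true`
and on the negative one if `s` is `false`. -/
noncomputable def dyadicLo (j : ℤ) (s : Bool) : ℝ := bif s then 2 ^ j else -2 ^ (j + 1)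

/-- The right end of the dyadic interval of size `2 ^ j` and sign `s`; see `dyadicLo`. -/
noncomputable def dyadicHi (j : ℤ) (s : Bool) : ℝ := bif s then 2 ^ (j + 1) else -2 ^ j

/-- The open dyadic interval `2 ^ j < |u| < 2 ^ (j + 1)` on one half-line. Open intervals cover only
up to a null set, but they are mapped to intervals of the same kind by reflections. -/
def dyadicIoo (j : ℤ) (s : Bool) : Set ℝ := Set.Ioo (dyadicLo j s) (dyadicHi j s)

theorem dyadicHi_sub_dyadicLo (j : ℤ) (s : Bool) : dyadicHi j s - dyadicLo j s = 2 ^ j := by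
  have : (2 : ℝ) ^ (j + 1) = 2 ^ j * 2 := zpow_add_one₀ (by norm_num) j
  cases s <;> simp [dyadicHi, dyadicLo, this] <;> ring

theorem abs_mem_of_mem_Icc_dyadic {j : ℤ} {s : Bool} {u : ℝ}
    (hu : u ∈ Set.Icc (dyadicLo j s) (dyadicHi j s)) : (2 : ℝ) ^ j ≤ |u| ∧ |u| ≤ 2 ^ (j + 1) := by
  have h0 : (0 : ℝ) < 2 ^ j := by positivity
  have h1 : (0 : ℝ) < 2 ^ (j + 1) := by positivity
  cases s <;> simp only [dyadicHi, dyadicLo, cond_true, cond_false, Set.mem_Icc] at hu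
  · rw [abs_of_neg (by linarith)]
    constructor <;> linarith
  · rw [abs_of_pos (by linarith)]
    exact hu

theorem mul_log_le_of_mem_Icc_dyadic {j : ℤ} {s : Bool} {u a : ℝ}
    (hu : u ∈ Set.Icc (dyadicLo j s) (dyadicHi j s)) :
    a * Real.log u ≤ Real.log 2 * (|a| + a * j) := by
  obtain ⟨h1, h2⟩ := abs_mem_of_mem_Icc_dyadic hu
  have h0 : (0 : ℝ) < 2 ^ j := by positivity
  have l1 := Real.log_le_log h0 h1
  have l2 := Real.log_le_log (h0.trans_le h1) h2
  rw [Real.log_abs, Real.log_zpow] at l1 l2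
  push_cast at l2
  rcases le_total 0 a with ha | ha
  · rw [abs_of_nonneg ha]; nlinarith
  · rw [abs_of_nonpos ha]
    have := Real.log_pos (by norm_num : (1 : ℝ) < 2)
    nlinarith

theorem exp_mul_logDamping_le {m : ℕ} (hm : 1 ≤ m) {a : ℝ} {j l : ℤ} {s s' : Bool} {u y : ℝ}
    (hu : u ∈ Set.Icc (dyadicLo j s) (dyadicHi j s))
    (hv : y - u ∈ Set.Icc (dyadicLo l s') (dyadicHi l s')) :
    Real.exp (a * logDamping m u y) ≤ (2 : ℝ) ^ (|a| * m + a * (j + l * ((m : ℝ) - 1))) := by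
  rw [Real.rpow_def_of_pos (by norm_num), Real.exp_le_exp, logDamping]
  have hm' : (0 : ℝ) ≤ (m : ℝ) - 1 := sub_nonneg.2 (by exact_mod_cast hm)
  have h1 := mul_log_le_of_mem_Icc_dyadic (a := a) hu
  have h2 := mul_le_mul_of_nonneg_left (mul_log_le_of_mem_Icc_dyadic (a := a) hv) hm'
  linarith

theorem le_rpow_mul_rpow_of_le {g x y : ℝ} (hg : 0 ≤ g) (hx : g ≤ x) (hy : g ≤ y) :
    g ≤ x ^ (1 / 4 : ℝ) * y ^ (3 / 4 : ℝ) := by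
  calc g = g ^ (1 / 4 : ℝ) * g ^ (3 / 4 : ℝ) := by
        rw [← Real.rpow_add_of_nonneg hg (by norm_num) (by norm_num)]; norm_num
    _ ≤ _ := by
      have := hg.trans hx
      gcongr

/-- The binary logarithm of the bound for the square of the norm of the operator on one dyadic box,
up to a constant: the size of the kernel squared times the area `2 ^ σ`, with
`σ = min j l + min k l`, times the gain from oscillation `2 ^ (-3 X / 4)` when `X ≥ 0`, where `X`
is `phaseSize`. -/
noncomputable def boxExponent (β m : ℕ) (a : ℝ) (j k l : ℤ) : ℝ :=
  2 * a * (j + l * ((m : ℝ) - 1)) + (min (j : ℝ) l + min (k : ℝ) l)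
    - 3 / 4 * max 0 (k * (β : ℝ) + l * (m : ℝ) + (min (j : ℝ) l + min (k : ℝ) l))

theorem IsMixedPhase.box_estimate {β m : ℕ} {c : ℝ} {P P₁ P₂ : ℝ → ℝ → ℝ}
    (hP : IsMixedPhase β m c P P₁ P₂) (hc : c ≠ 0) (hm : 1 ≤ m) (z : ℂ) (j k l : ℤ)
    (s₁ s₂ s₃ : Bool) {f : ℝ → ℂ} (hf : Measurable f) {Mf : ℝ} (hMf : ∀ y, ‖f y‖ ≤ Mf) :
    ∫⁻ u, ‖∫ y, boxKernel (logKernel P m z) (dyadicIoo j s₁) (dyadicIoo k s₂) (dyadicIoo l s₃)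
        u y * f y‖ₑ ^ 2
      ≤ ENNReal.ofReal (8 * (1 + (2 + m + 2 * m * ‖z‖) / |c|) * 2 ^ (2 * |z.re| * m)
          * 2 ^ boxExponent β m z.re j k l) * ∫⁻ y in dyadicIoo k s₂, ‖f y‖ₑ ^ 2 := by
  set κ := boxKernel (logKernel P m z) (dyadicIoo j s₁) (dyadicIoo k s₂) (dyadicIoo l s₃) with hκ
  set a := z.re with ha
  set C₁ := (2 + m + 2 * m * ‖z‖) / |c| with hC₁
  have hC₁0 : 0 ≤ C₁ := by positivity
  set E : ℝ := |a| * m + a * (j + l * ((m : ℝ) - 1)) with hE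
  have hzp : ∀ n : ℤ, (2 : ℝ) ^ n = 2 ^ (n : ℝ) := fun n ↦ (Real.rpow_intCast 2 n).symm
  have hmin : ∀ n n' : ℤ, min ((2 : ℝ) ^ n) (2 ^ n') = 2 ^ min (n : ℝ) n' := fun n n' ↦ by
    rw [hzp, hzp]
    exact ((Real.monotone_rpow_of_base_ge_one (by norm_num : (1 : ℝ) ≤ 2)).map_min).symm
  have hA : ∀ u y, κ u y ≠ 0 → ‖κ u y‖ ≤ 2 ^ E := fun u y h ↦ by
    have hmem := not_imp_comm.1 boxKernel_of_notMem h
    rw [hκ, boxKernel_of_mem hmem, norm_logKernel]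
    exact exp_mul_logDamping_le hm (Set.Ioo_subset_Icc_self hmem.1)
      (Set.Ioo_subset_Icc_self hmem.2.2)
  have hA' : ∀ u y, ‖κ u y‖ ≤ 2 ^ E := fun u y ↦ by
    by_cases h : κ u y = 0
    · rw [h, norm_zero]; positivity
    · exact hA u y h
  have hgram := fun y₁ (hy₁ : y₁ ∈ dyadicIoo k s₂) y₂ (hy₂ : y₂ ∈ dyadicIoo k s₂)
      (hne : y₁ ≠ y₂) ↦
    hP.gram_bound hc hm (p₁ := dyadicLo j s₁) (p₂ := dyadicHi j s₁) (q₁ := dyadicLo k s₂)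
      (q₂ := dyadicHi k s₂) (w₁ := dyadicLo l s₃) (w₂ := dyadicHi l s₃)
      (ρ₁ := 2 ^ j) (ρ₂ := 2 ^ k) (ρ₃ := 2 ^ l) (A := 2 ^ E) (z := z)
      (by positivity) (by positivity) (by positivity)
      (fun u hu ↦ (abs_mem_of_mem_Icc_dyadic hu).1) (dyadicHi_sub_dyadicLo j s₁).le
      (fun u hu ↦ (abs_mem_of_mem_Icc_dyadic hu).1)
      (fun u hu ↦ (abs_mem_of_mem_Icc_dyadic hu).1) (dyadicHi_sub_dyadicLo l s₃).le
      (by positivity) (fun u hu y hy ↦ exp_mul_logDamping_le hm hu hy) hy₁ hy₂ hne rfl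
  set ρ : ℝ := 2 ^ min (k : ℝ) l with hρ
  have hρ0 : 0 < ρ := by positivity
  -- Two points of a box with a common `u` are closer than `ρ`.
  have hsmall : ∀ y₁ ∈ dyadicIoo k s₂, ∀ y₂ ∈ dyadicIoo k s₂, y₁ ≠ y₂ →
      y₁ - y₂ ∉ Set.Ioo (-ρ) ρ → ∫ x, (starRingEnd ℂ) (κ x y₁) * κ x y₂ = 0 := by
    intro y₁ hy₁ y₂ hy₂ hne ht
    refine (hgram y₁ hy₁ y₂ hy₂ hne).2.2 ?_
    rw [Set.mem_Ioo, ← abs_lt, not_lt, hρ, ← hmin] at ht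
    have hk : |y₁ - y₂| < 2 ^ k := by
      have := dyadicHi_sub_dyadicLo k s₂
      obtain ⟨_, _⟩ := hy₁
      obtain ⟨_, _⟩ := hy₂
      rw [abs_lt]; constructor <;> linarith
    rcases min_le_iff.1 ht with h | h
    · exact absurd hk (not_lt.2 h)
    · exact h
  have hJtop : volume (dyadicIoo k s₂) ≠ ⊤ := by simp [dyadicIoo]
  have hItop : volume (dyadicIoo j s₁) ≠ ⊤ := by simp [dyadicIoo]
  have hschur := fun (g : ℝ → ℝ≥0∞) (hg : Measurable g) (hge : ∀ t, g (-t) = g t) hG ↦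
    lintegral_sq_integral_le_of_gram (k := κ)
      (measurable_boxKernel (measurable_logKernel hP.continuous m z) measurableSet_Ioo
        measurableSet_Ioo measurableSet_Ioo) hA' (I := dyadicIoo j s₁) (J := dyadicIoo k s₂)
      measurableSet_Ioo hItop hJtop
      (fun u y h ↦ by
        have hmem := not_imp_comm.1 boxKernel_of_notMem h
        exact ⟨hmem.1, hmem.2.1⟩) hf hMf hg hge hG
  have hsymm : ∀ t : ℝ, -t ∈ Set.Ioo (-ρ) ρ ↔ t ∈ Set.Ioo (-ρ) ρ := fun t ↦ by
    constructor <;> rintro ⟨_, _⟩ <;> constructor <;> linarith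
  set W : ℝ := 2 * a * (j + l * ((m : ℝ) - 1)) with hW
  set X : ℝ := k * (β : ℝ) + l * (m : ℝ) + (min (j : ℝ) l + min (k : ℝ) l) with hX
  have hEW : ((2 : ℝ) ^ E) ^ 2 = 2 ^ (2 * |a| * m + W) := by
    rw [← Real.rpow_natCast, ← Real.rpow_mul (by norm_num), hE, hW]
    congr 1; push_cast; ring
  -- For `X ≤ 0` the trivial bound is used, for `X ≥ 0` the interpolated one.
  rcases le_total X 0 with hX0 | hX0
  · set D : ℝ := 2 ^ (2 * |a| * m + W) * 2 ^ min (j : ℝ) l with hD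
    refine (hschur ((Set.Ioo (-ρ) ρ).indicator fun _ ↦ ENNReal.ofReal D)
      (measurable_const.indicator measurableSet_Ioo)
      (fun t ↦ by simp only [Set.indicator, hsymm]) fun y₁ hy₁ y₂ hy₂ hne ↦ ?_).trans ?_
    · by_cases ht : y₁ - y₂ ∈ Set.Ioo (-ρ) ρ
      · rw [Set.indicator_of_mem ht, ← ofReal_norm]
        refine ENNReal.ofReal_le_ofReal ((hgram y₁ hy₁ y₂ hy₂ hne).1.trans_eq ?_)
        rw [hEW, hmin]
      · rw [hsmall y₁ hy₁ y₂ hy₂ hne ht]; simp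
    · gcongr
      rw [lintegral_indicator measurableSet_Ioo, setLIntegral_const, Real.volume_Ioo,
        ← ENNReal.ofReal_mul (by positivity)]
      refine ENNReal.ofReal_le_ofReal ?_
      have : boxExponent β m a j k l = W + (min (j : ℝ) l + min (k : ℝ) l) := by
        rw [boxExponent, ← hW, ← hX, max_eq_left hX0]; ring
      rw [this, hD, hρ, Real.rpow_add (by norm_num), Real.rpow_add (by norm_num),
        Real.rpow_add (by norm_num)]
      have h8 : (2 : ℝ) ≤ 8 * (1 + C₁) := by linarith
      calc _ = 2 * (2 ^ (2 * |a| * (m : ℝ)) *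
            ((2 : ℝ) ^ W * (2 ^ min (j : ℝ) l * 2 ^ min (k : ℝ) l))) := by
            ring
        _ ≤ 8 * (1 + C₁) * (2 ^ (2 * |a| * (m : ℝ)) *
            ((2 : ℝ) ^ W * (2 ^ min (j : ℝ) l * 2 ^ min (k : ℝ) l))) := by gcongr
        _ = _ := by ring
  · set D : ℝ := (1 + C₁) * 2 ^ (2 * |a| * m + W + min (j : ℝ) l / 4
      - 3 / 4 * (k * (β : ℝ) + l * (m : ℝ))) with hD
    have hD0 : 0 ≤ D := by positivity
    refine (hschur ((Set.Ioo (-ρ) ρ).indicator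
      fun t ↦ ENNReal.ofReal (D * |t| ^ (-(3 / 4) : ℝ)))
      (Measurable.indicator (by fun_prop) measurableSet_Ioo)
      (fun t ↦ by simp only [Set.indicator, hsymm, abs_neg]) fun y₁ hy₁ y₂ hy₂ hne ↦ ?_).trans ?_
    · by_cases ht : y₁ - y₂ ∈ Set.Ioo (-ρ) ρ
      · rw [Set.indicator_of_mem ht, ← ofReal_norm]
        refine ENNReal.ofReal_le_ofReal ?_
        obtain ⟨g1, g2, -⟩ := hgram y₁ hy₁ y₂ hy₂ hne
        have habs : 0 < |y₁ - y₂| := abs_pos.2 (sub_ne_zero.2 hne)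
        refine (le_rpow_mul_rpow_of_le (norm_nonneg _) g1 g2).trans ?_
        rw [hEW, hmin, ← hC₁]
        have hμ : ((2 : ℝ) ^ k) ^ β * ((2 : ℝ) ^ l) ^ m = 2 ^ (k * (β : ℝ) + l * (m : ℝ)) := by
          rw [hzp, hzp, ← Real.rpow_natCast, ← Real.rpow_natCast, ← Real.rpow_mul (by norm_num),
            ← Real.rpow_mul (by norm_num), ← Real.rpow_add (by norm_num)]
        have hC₁' : C₁ ^ (3 / 4 : ℝ) ≤ 1 + C₁ :=
          (Real.rpow_le_rpow hC₁0 (by linarith) (by norm_num)).trans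
            (Real.rpow_le_self_of_one_le (by linarith) (by norm_num))
        rw [hμ, ← Real.rpow_add (by norm_num), ← Real.rpow_mul (by norm_num)]
        rw [Real.div_rpow (by positivity) (by positivity), Real.mul_rpow (by positivity) hC₁0,
          Real.mul_rpow (by positivity) habs.le, ← Real.rpow_mul (by norm_num),
          ← Real.rpow_mul (by norm_num), Real.rpow_neg habs.le, hD]
        have hexp : (2 : ℝ) ^ (2 * |a| * m + W + min (j : ℝ) l / 4
            - 3 / 4 * (k * (β : ℝ) + l * (m : ℝ)))
            = 2 ^ ((2 * |a| * m + W + min (j : ℝ) l) * (1 / 4)) * 2 ^ ((2 * |a| * m + W) * (3 / 4))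
              / 2 ^ ((k * (β : ℝ) + l * (m : ℝ)) * (3 / 4)) := by
          rw [← Real.rpow_add (by norm_num), ← Real.rpow_sub (by norm_num)]
          congr 1; ring
        rw [hexp]
        calc _ = C₁ ^ (3 / 4 : ℝ) * (2 ^ ((2 * |a| * m + W + min (j : ℝ) l) * (1 / 4))
                * 2 ^ ((2 * |a| * m + W) * (3 / 4))
              / 2 ^ ((k * (β : ℝ) + l * (m : ℝ)) * (3 / 4))) * (|y₁ - y₂| ^ (3 / 4 : ℝ))⁻¹ := by
              field_simp
          _ ≤ _ := by gcongr
      · rw [hsmall y₁ hy₁ y₂ hy₂ hne ht]; simp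
    · gcongr
      refine (lintegral_indicator_abs_rpow_le hD0 hρ0).trans (ENNReal.ofReal_le_ofReal ?_)
      have : boxExponent β m a j k l
          = W + min (j : ℝ) l / 4 - 3 / 4 * (k * (β : ℝ) + l * (m : ℝ))
            + min (k : ℝ) l * (1 / 4) := by
        rw [boxExponent, ← hW, ← hX, max_eq_right hX0, hX]; ring
      rw [this, hD, hρ, ← Real.rpow_mul (by norm_num)]
      refine le_of_eq ?_
      have e1 : (2 : ℝ) ^ (2 * |a| * m + W + min (j : ℝ) l / 4
            - 3 / 4 * (k * (β : ℝ) + l * (m : ℝ))) = 2 ^ (2 * |a| * (m : ℝ)) *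
          2 ^ (W + min (j : ℝ) l / 4 - 3 / 4 * (k * (β : ℝ) + l * (m : ℝ))) := by
        rw [← Real.rpow_add (by norm_num)]; congr 1; ring
      rw [e1, Real.rpow_add (by norm_num) (W + _ - _)]
      ring

/-! ### Summation over the boxes -/

theorem abs_lt_of_mem_dyadicIoo {j : ℤ} {s : Bool} {u : ℝ} (h : u ∈ dyadicIoo j s) :
    2 ^ j < |u| ∧ |u| < 2 ^ (j + 1) := by
  have h0 : (0 : ℝ) < 2 ^ j := by positivity
  have h1 : (0 : ℝ) < 2 ^ (j + 1) := by positivity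
  obtain ⟨h3, h4⟩ := h
  cases s <;> simp only [dyadicHi, dyadicLo, cond_true, cond_false] at h3 h4
  · rw [abs_of_neg (by linarith)]; constructor <;> linarith
  · rw [abs_of_pos (by linarith)]; constructor <;> linarith

theorem dyadicIoo_index_unique {j j' : ℤ} {s s' : Bool} {u : ℝ} (h : u ∈ dyadicIoo j s)
    (h' : u ∈ dyadicIoo j' s') : j = j' ∧ s = s' := by
  have hj : j = j' := by
    have key : ∀ {i i' : ℤ} {t t' : Bool}, u ∈ dyadicIoo i t → u ∈ dyadicIoo i' t' → i ≤ i' := by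
      intro i i' t t' h h'
      have := (zpow_lt_zpow_iff_right₀ (by norm_num : (1 : ℝ) < 2)).1
        ((abs_lt_of_mem_dyadicIoo h).1.trans (abs_lt_of_mem_dyadicIoo h').2)
      exact Int.lt_add_one_iff.1 this
    exact le_antisymm (key h h') (key h' h)
  refine ⟨hj, ?_⟩
  have h0 : (0 : ℝ) < 2 ^ j := by positivity
  have h1 : (0 : ℝ) < 2 ^ j' := by positivity
  obtain ⟨h3, h4⟩ := h
  obtain ⟨h5, h6⟩ := h'
  cases s <;> cases s' <;> simp only [dyadicHi, dyadicLo, cond_true, cond_false] at h3 h4 h5 h6 <;>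
    first | rfl | (exfalso; linarith)

/-- The points that lie in no dyadic interval `dyadicIoo j s`. -/
def dyadicEndpoints : Set ℝ := {0} ∪ (Set.range fun n : ℤ ↦ (2 : ℝ) ^ n) ∪
  Set.range fun n : ℤ ↦ -(2 : ℝ) ^ n

theorem countable_dyadicEndpoints : dyadicEndpoints.Countable :=
  ((Set.countable_singleton _).union (Set.countable_range _)).union (Set.countable_range _)

theorem exists_mem_dyadicIoo {u : ℝ} (hu : u ∉ dyadicEndpoints) :
    ∃ p : ℤ × Bool, u ∈ dyadicIoo p.1 p.2 := by
  simp only [dyadicEndpoints, Set.mem_union, Set.mem_singleton_iff, Set.mem_range, not_or,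
    not_exists] at hu
  obtain ⟨⟨h0, h1⟩, h2⟩ := hu
  have habs : 0 < |u| := abs_pos.2 h0
  have e1 := Int.zpow_log_le_self (b := 2) (by norm_num) habs
  have e2 := Int.lt_zpow_succ_log_self (b := 2) (by norm_num) |u|
  simp only [Nat.cast_ofNat] at e1 e2
  refine ⟨(Int.log 2 |u|, decide (0 < u)), ?_⟩
  rcases lt_or_gt_of_ne h0 with h | h
  · have hd : decide (0 < u) = false := by simp [h.le]
    rw [hd]
    rw [abs_of_neg h] at e1 e2 ⊢
    refine ⟨?_, lt_of_le_of_ne ?_ (fun hh ↦ h2 _ hh.symm)⟩ <;>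
      simp only [dyadicHi, dyadicLo, cond_false] <;> linarith
  · have hd : decide (0 < u) = true := by simp [h]
    rw [hd]
    rw [abs_of_pos h] at e1 e2 ⊢
    exact ⟨lt_of_le_of_ne e1 (h1 _), e2⟩

theorem ae_notMem_dyadicEndpoints_sub (u : ℝ) : ∀ᵐ y : ℝ, y - u ∉ dyadicEndpoints := by
  have : (((fun y : ℝ ↦ y - u)) ⁻¹' dyadicEndpoints).Countable :=
    countable_dyadicEndpoints.preimage (sub_left_injective)
  exact this.ae_notMem volume

/-- The operator with kernel `K` cut off to the box `b`, whose index consists of the exponents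
`(j, k, l)` and the signs of `u`, `y` and `y - u`. -/
noncomputable def boxOp (K : ℝ → ℝ → ℂ) (f : ℝ → ℂ) (b : (ℤ × ℤ × ℤ) × (Bool × Bool × Bool))
    (u : ℝ) : ℂ :=
  ∫ y, boxKernel K (dyadicIoo b.1.1 b.2.1) (dyadicIoo b.1.2.1 b.2.2.1)
    (dyadicIoo b.1.2.2 b.2.2.2) u y * f y

/-- No integrability is assumed: where `K (u, y) f (y)` is not integrable in `y`, the left side is
zero by convention. -/
theorem enorm_integral_le_tsum_boxOp (K : ℝ → ℝ → ℂ) (f : ℝ → ℂ) {u : ℝ}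
    (hu : u ∉ dyadicEndpoints) :
    ‖∫ y, K u y * f y‖ₑ ≤ ∑' b, ‖boxOp K f b u‖ₑ := by
  by_cases hi : Integrable fun y ↦ K u y * f y
  swap
  · rw [integral_undef hi]; simp
  obtain ⟨⟨j, s⟩, hj⟩ := exists_mem_dyadicIoo hu
  set S : (ℤ × Bool) × (ℤ × Bool) → Set ℝ := fun p ↦
    dyadicIoo p.1.1 p.1.2 ∩ (fun y ↦ y - u) ⁻¹' dyadicIoo p.2.1 p.2.2 with hS
  have hSm : ∀ p, MeasurableSet (S p) := fun p ↦
    measurableSet_Ioo.inter ((measurable_id.sub_const u) measurableSet_Ioo)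
  have hSd : Pairwise (Function.onFun Disjoint S) := by
    intro p p' hne
    refine Set.disjoint_left.2 fun y hy hy' ↦ hne ?_
    have h1 := dyadicIoo_index_unique hy.1 hy'.1
    have h2 := dyadicIoo_index_unique hy.2 hy'.2
    exact Prod.ext (Prod.ext h1.1 h1.2) (Prod.ext h2.1 h2.2)
  have hSU : (⋃ p, S p) =ᵐ[volume] Set.univ := by
    filter_upwards [countable_dyadicEndpoints.ae_notMem volume, ae_notMem_dyadicEndpoints_sub u]
      with y hy hy'
    obtain ⟨p, hp⟩ := exists_mem_dyadicIoo hy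
    obtain ⟨q, hq⟩ := exists_mem_dyadicIoo hy'
    exact propext ⟨fun _ ↦ trivial, fun _ ↦ Set.mem_iUnion.2 ⟨(p, q), hp, hq⟩⟩
  have hsum := hasSum_integral_iUnion hSm hSd (hi.integrableOn (s := ⋃ p, S p))
  rw [setIntegral_congr_set hSU, setIntegral_univ] at hsum
  have hpiece : ∀ p, ∫ y in S p, K u y * f y
      = boxOp K f ((j, p.1.1, p.2.1), (s, p.1.2, p.2.2)) u := fun p ↦ by
    rw [boxOp, ← integral_indicator (hSm p)]
    congr 1 with y
    by_cases hy : y ∈ S p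
    · have h : u ∈ dyadicIoo j s ∧ y ∈ dyadicIoo p.1.1 p.1.2 ∧ y - u ∈ dyadicIoo p.2.1 p.2.2 :=
        ⟨hj, hy.1, hy.2⟩
      rw [Set.indicator_of_mem hy, boxKernel_of_mem h]
    · have h : ¬ (u ∈ dyadicIoo j s ∧ y ∈ dyadicIoo p.1.1 p.1.2 ∧ y - u ∈ dyadicIoo p.2.1 p.2.2) :=
        fun h ↦ hy ⟨h.2.1, h.2.2⟩
      rw [Set.indicator_of_notMem hy, boxKernel_of_notMem h, zero_mul]
  rw [← hsum.tsum_eq]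
  simp only [hpiece]
  refine enorm_tsum_le_tsum_enorm.trans ?_
  refine ENNReal.tsum_comp_le_tsum_of_injective
    (f := fun p : (ℤ × Bool) × (ℤ × Bool) ↦ (((j, p.1.1, p.2.1), (s, p.1.2, p.2.2)) :
      (ℤ × ℤ × ℤ) × (Bool × Bool × Bool))) ?_ (fun b ↦ ‖boxOp K f b u‖ₑ)
  rintro ⟨⟨a, b⟩, c, d⟩ ⟨⟨a', b'⟩, c', d'⟩ h
  simp only [Prod.mk.injEq] at h ⊢
  tauto

/-- The box with `j > max k l + 1` is empty, as `|u| ≤ |y| + |y - u|`. -/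
theorem boxOp_eq_zero_of_max_lt (K : ℝ → ℝ → ℂ) (f : ℝ → ℂ)
    {b : (ℤ × ℤ × ℤ) × (Bool × Bool × Bool)} (hb : max b.1.2.1 b.1.2.2 + 1 < b.1.1) (u : ℝ) :
    boxOp K f b u = 0 := by
  rw [boxOp]
  rw [← integral_zero ℝ ℂ (μ := volume)]
  congr 1 with y
  rw [boxKernel_of_notMem, zero_mul]
  rintro ⟨h1, h2, h3⟩
  have h1 := (abs_lt_of_mem_dyadicIoo h1).1
  have h2 := (abs_lt_of_mem_dyadicIoo h2).2
  have h3 := (abs_lt_of_mem_dyadicIoo h3).2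
  set M := max b.1.2.1 b.1.2.2 with hM
  have e2 : (2 : ℝ) ^ (b.1.2.1 + 1) ≤ 2 ^ (M + 1) :=
    zpow_le_zpow_right₀ (by norm_num) (by have := le_max_left b.1.2.1 b.1.2.2; omega)
  have e3 : (2 : ℝ) ^ (b.1.2.2 + 1) ≤ 2 ^ (M + 1) :=
    zpow_le_zpow_right₀ (by norm_num) (by have := le_max_right b.1.2.1 b.1.2.2; omega)
  have e4 : (2 : ℝ) ^ (M + 1 + 1) ≤ 2 ^ b.1.1 :=
    zpow_le_zpow_right₀ (by norm_num) (by omega)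
  rw [zpow_add_one₀ (by norm_num)] at e4
  have e5 : |u| ≤ |y| + |y - u| := by
    have := abs_sub y (y - u)
    rwa [sub_sub_cancel] at this
  linarith

/-- A point lies in at most one interval `dyadicIoo j s`, and the signs contribute a factor `8`. -/
theorem tsum_box_row_le (n : ℤ → ℤ → ℤ → ℝ≥0∞) {W : ℝ≥0∞} (hW : ∀ j, ∑' k, ∑' l, n j k l ≤ W)
    (u : ℝ) :
    ∑' b : (ℤ × ℤ × ℤ) × (Bool × Bool × Bool),
      (dyadicIoo b.1.1 b.2.1).indicator (fun _ ↦ n b.1.1 b.1.2.1 b.1.2.2) u ≤ 8 * W := by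
  by_cases hu : ∃ p : ℤ × Bool, u ∈ dyadicIoo p.1 p.2
  · obtain ⟨⟨j₀, s₀⟩, h₀⟩ := hu
    calc _ ≤ ∑' b : (ℤ × ℤ × ℤ) × (Bool × Bool × Bool),
          if b.1.1 = j₀ then n b.1.1 b.1.2.1 b.1.2.2 else 0 := by
          refine ENNReal.tsum_le_tsum fun b ↦ ?_
          by_cases hb : u ∈ dyadicIoo b.1.1 b.2.1
          · rw [Set.indicator_of_mem hb, if_pos (dyadicIoo_index_unique hb h₀).1]
          · simp [hb]
      _ = 8 * ∑' k, ∑' l, n j₀ k l := by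
          rw [ENNReal.tsum_prod', ← ENNReal.tsum_mul_left]
          simp only [tsum_fintype, Finset.sum_const, Finset.card_univ, Fintype.card_prod,
            Fintype.card_bool]
          rw [ENNReal.tsum_prod', tsum_eq_single j₀ (fun j hj ↦ by simp [hj])]
          simp only [if_true]
          rw [ENNReal.tsum_prod']
          refine tsum_congr fun k ↦ ?_
          rw [← ENNReal.tsum_mul_left]
          refine tsum_congr fun l ↦ ?_
          rw [nsmul_eq_mul]; norm_num
      _ ≤ _ := by gcongr; exact hW j₀
  · push Not at hu
    have : ∀ b : (ℤ × ℤ × ℤ) × (Bool × Bool × Bool),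
      (dyadicIoo b.1.1 b.2.1).indicator (fun _ ↦ n b.1.1 b.1.2.1 b.1.2.2) u = 0 := fun b ↦
        Set.indicator_of_notMem (hu (b.1.1, b.2.1)) _
    simp [this]

theorem tsum_box_col_le (n : ℤ → ℤ → ℤ → ℝ≥0∞) {W : ℝ≥0∞} (hW : ∀ k, ∑' j, ∑' l, n j k l ≤ W)
    (y : ℝ) :
    ∑' b : (ℤ × ℤ × ℤ) × (Bool × Bool × Bool),
      (dyadicIoo b.1.2.1 b.2.2.1).indicator (fun _ ↦ n b.1.1 b.1.2.1 b.1.2.2) y ≤ 8 * W := by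
  by_cases hy : ∃ p : ℤ × Bool, y ∈ dyadicIoo p.1 p.2
  · obtain ⟨⟨k₀, s₀⟩, h₀⟩ := hy
    calc _ ≤ ∑' b : (ℤ × ℤ × ℤ) × (Bool × Bool × Bool),
          if b.1.2.1 = k₀ then n b.1.1 b.1.2.1 b.1.2.2 else 0 := by
          refine ENNReal.tsum_le_tsum fun b ↦ ?_
          by_cases hb : y ∈ dyadicIoo b.1.2.1 b.2.2.1
          · rw [Set.indicator_of_mem hb, if_pos (dyadicIoo_index_unique hb h₀).1]
          · simp [hb]
      _ = 8 * ∑' j, ∑' l, n j k₀ l := by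
          rw [ENNReal.tsum_prod', ← ENNReal.tsum_mul_left]
          simp only [tsum_fintype, Finset.sum_const, Finset.card_univ, Fintype.card_prod,
            Fintype.card_bool]
          rw [ENNReal.tsum_prod']
          refine tsum_congr fun j ↦ ?_
          rw [ENNReal.tsum_prod', tsum_eq_single k₀ (fun k hk ↦ by simp [hk])]
          simp only [if_true]
          rw [← ENNReal.tsum_mul_left]
          refine tsum_congr fun l ↦ ?_
          rw [nsmul_eq_mul]; norm_num
      _ ≤ _ := by gcongr; exact hW k₀
  · push Not at hy
    have : ∀ b : (ℤ × ℤ × ℤ) × (Bool × Bool × Bool),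
      (dyadicIoo b.1.2.1 b.2.2.1).indicator (fun _ ↦ n b.1.1 b.1.2.1 b.1.2.2) y = 0 := fun b ↦
        Set.indicator_of_notMem (hy (b.1.2.1, b.2.2.1)) _
    simp [this]

/-- The `L²` estimate for the normalised kernel at the critical damping. -/
theorem IsMixedPhase.exists_lintegral_sq_le {β m : ℕ} {c : ℝ} {P P₁ P₂ : ℝ → ℝ → ℝ}
    (hP : IsMixedPhase β m c P P₁ P₂) (hc : c ≠ 0) (hβ : 1 ≤ β) (hm : 1 ≤ m) {a : ℝ}
    (ha : 2 * a = ((m : ℝ) - β) / (((β : ℝ) + 1) * m)) :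
    ∃ A : ℝ, 0 ≤ A ∧ ∀ z : ℂ, z.re = a → ∀ f : ℝ → ℂ, Measurable f → (∃ Mf, ∀ y, ‖f y‖ ≤ Mf) →
      ∫⁻ u, ‖∫ y, logKernel P m z u y * f y‖ₑ ^ 2
        ≤ ENNReal.ofReal (A * (1 + ‖z‖)) * ∫⁻ y, ‖f y‖ₑ ^ 2 := by
  have hβ' : (1 : ℝ) ≤ β := by exact_mod_cast hβ
  have hm' : (1 : ℝ) ≤ m := by exact_mod_cast hm
  set κ : ℝ := 1 / (2 * ((β : ℝ) + 1) * m) with hκ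
  have hκ0 : 0 < κ := by positivity
  set w : ℤ → ℝ≥0∞ := fun n ↦ ENNReal.ofReal ((2 : ℝ) ^ (-(κ / 2 * |(n : ℝ)|))) with hw
  set W : ℝ≥0∞ := ∑' n, w n with hW
  have hWtop : W ≠ ⊤ := tsum_int_geometric_ne_top (by positivity)
  set B : ℝ := 16 * (1 + (2 + 2 * m) / |c|) * 2 ^ (2 * |a| * m) with hB
  have hB0 : 0 < B := by positivity
  refine ⟨64 * B * W.toReal ^ 4, by positivity, fun z hz f hf ⟨Mf, hMf⟩ ↦ ?_⟩
  obtain ⟨C, hC⟩ : ∃ C, C = B * (1 + ‖z‖) := ⟨_, rfl⟩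
  have hC0 : 0 < C := by rw [hC]; positivity
  -- The bound for the norm of the operator on the box `(j, k, l)`.
  set n : ℤ → ℤ → ℤ → ℝ≥0∞ := fun j k l ↦
    ENNReal.ofReal (√C) * (w (phaseSize β m j k l) * w (j - l))
    with hn
  have hw0 : ∀ i, w i ≠ 0 := fun i ↦ (ENNReal.ofReal_pos.2 (by positivity)).ne'
  have hrow : ∀ j, ∑' k, ∑' l, n j k l ≤ ENNReal.ofReal (√C) * (W * W) := fun j ↦ by
    simp only [hn, ENNReal.tsum_mul_left]
    gcongr
    exact tsum_row_weight_le (by exact_mod_cast hβ) w j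
  have hcol : ∀ k, ∑' j, ∑' l, n j k l ≤ ENNReal.ofReal (√C) * (W * W) := fun k ↦ by
    simp only [hn, ENNReal.tsum_mul_left]
    gcongr
    exact tsum_col_weight_le (by exact_mod_cast hm) w k
  have hmeas : ∀ b, Measurable (boxOp (logKernel P m z) f b) := fun b ↦ by
    have h := (measurable_boxKernel (measurable_logKernel hP.continuous m z)
      (measurableSet_Ioo (a := dyadicLo b.1.1 b.2.1) (b := dyadicHi b.1.1 b.2.1))
      (measurableSet_Ioo (a := dyadicLo b.1.2.1 b.2.2.1) (b := dyadicHi b.1.2.1 b.2.2.1))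
      (measurableSet_Ioo (a := dyadicLo b.1.2.2 b.2.2.2) (b := dyadicHi b.1.2.2 b.2.2.2))).mul
      (hf.comp measurable_snd)
    exact h.stronglyMeasurable.integral_prod_right'.measurable
  have hblock : ∀ b : (ℤ × ℤ × ℤ) × (Bool × Bool × Bool),
      ∫⁻ u, ‖boxOp (logKernel P m z) f b u‖ₑ ^ 2
        ≤ (n b.1.1 b.1.2.1 b.1.2.2) ^ 2 * ∫⁻ y in dyadicIoo b.1.2.1 b.2.2.1, ‖f y‖ₑ ^ 2 := by
    rintro ⟨⟨j, k, l⟩, s₁, s₂, s₃⟩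
    rcases lt_or_ge (max k l + 1) j with hjkl | hjkl
    · simp [boxOp_eq_zero_of_max_lt (logKernel P m z) f (b := ((j, k, l), s₁, s₂, s₃)) hjkl]
    · refine (hP.box_estimate hc hm z j k l s₁ s₂ s₃ hf hMf).trans ?_
      gcongr
      simp only [hn, hw]
      rw [← ENNReal.ofReal_mul (by positivity), ← ENNReal.ofReal_mul (by positivity),
        ← ENNReal.ofReal_pow (by positivity)]
      refine ENNReal.ofReal_le_ofReal ?_
      rw [mul_pow, Real.sq_sqrt hC0.le, mul_pow, ← Real.rpow_natCast, ← Real.rpow_natCast,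
        ← Real.rpow_mul (by norm_num), ← Real.rpow_mul (by norm_num),
        ← Real.rpow_add (by norm_num)]
      have hbal := critical_exponent_balance (a := a) hβ' hm' ha (j := j) (k := k) (l := l)
        (by exact_mod_cast hjkl)
      have hQ : (2 : ℝ) ^ boxExponent β m z.re j k l
          ≤ 2 * 2 ^ (-(κ / 2 * |((phaseSize β m j k l : ℤ) : ℝ)|) * (2 : ℕ)
          + -(κ / 2 * |((j - l : ℤ) : ℝ)|) * (2 : ℕ)) := by
        rw [hz]
        calc (2 : ℝ) ^ boxExponent β m a j k l
            ≤ 2 ^ (1 + (-(κ / 2 * |((phaseSize β m j k l : ℤ) : ℝ)|) * (2 : ℕ)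
          + -(κ / 2 * |((j - l : ℤ) : ℝ)|) * (2 : ℕ))) := by
              refine Real.rpow_le_rpow_of_exponent_le (by norm_num) (hbal.trans_eq ?_)
              simp only [phaseSize]
              push_cast
              ring
          _ = _ := by rw [Real.rpow_add (by norm_num), Real.rpow_one]
      have hC₁ : 1 + (2 + m + 2 * m * ‖z‖) / |c| ≤ (1 + (2 + 2 * m) / |c|) * (1 + ‖z‖) := by
        have : (2 + m + 2 * m * ‖z‖) / |c| ≤ (2 + 2 * m) * (1 + ‖z‖) / |c| := by
          gcongr
          nlinarith [norm_nonneg z]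
        have h2 : (1 + (2 + 2 * m) / |c|) * (1 + ‖z‖)
          = 1 + ‖z‖ + (2 + 2 * m) * (1 + ‖z‖) / |c| := by ring
        rw [h2]
        linarith [norm_nonneg z]
      rw [hz] at hQ ⊢
      calc _ ≤ 8 * ((1 + (2 + 2 * m) / |c|) * (1 + ‖z‖)) * 2 ^ (2 * |a| * m) *
            (2 * 2 ^ (-(κ / 2 * |((phaseSize β m j k l : ℤ) : ℝ)|) * (2 : ℕ)
              + -(κ / 2 * |((j - l : ℤ) : ℝ)|) * (2 : ℕ))) := by gcongr
        _ = _ := by rw [hC, hB]; ring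
  have := lintegral_sq_le_of_blocks (μ := volume) (F := fun u ↦ ∫ y, logKernel P m z u y * f y)
    (Fb := boxOp (logKernel P m z) f) (f := f) hmeas hf
    (N := fun b ↦ n b.1.1 b.1.2.1 b.1.2.2)
    (I := fun b ↦ dyadicIoo b.1.1 b.2.1) (J := fun b ↦ dyadicIoo b.1.2.1 b.2.2.1)
    (fun b u hu ↦ by
      rw [boxOp, ← integral_zero ℝ ℂ (μ := volume)]
      congr 1 with y
      rw [boxKernel_of_notMem (fun h ↦ hu h.1), zero_mul])
    (fun b ↦ measurableSet_Ioo)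
    (fun b ↦ mul_ne_zero (ENNReal.ofReal_pos.2 (by positivity)).ne' (mul_ne_zero (hw0 _) (hw0 _)))
    (fun b ↦ ENNReal.mul_ne_top ENNReal.ofReal_ne_top
      (ENNReal.mul_ne_top ENNReal.ofReal_ne_top ENNReal.ofReal_ne_top))
    ((countable_dyadicEndpoints.ae_notMem volume).mono fun u hu ↦
      enorm_integral_le_tsum_boxOp _ f hu)
    hblock (tsum_box_row_le n hrow) (tsum_box_col_le n hcol)
  refine this.trans_eq ?_
  congr 1
  have hCC : ENNReal.ofReal (√C) * ENNReal.ofReal (√C) = ENNReal.ofReal C := by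
    rw [← ENNReal.ofReal_mul (by positivity), Real.mul_self_sqrt hC0.le]
  calc _ = 64 * (ENNReal.ofReal (√C) * ENNReal.ofReal (√C)) * W ^ 4 := by ring
    _ = ENNReal.ofReal (64 * C * W.toReal ^ 4) := by
      rw [hCC, ENNReal.ofReal_mul (by positivity), ENNReal.ofReal_mul (by norm_num),
        ENNReal.ofReal_pow (by positivity), ENNReal.ofReal_toReal hWtop]
      norm_num
    _ = _ := by congr 1; rw [hC]; ring

/-! ### Polynomial phases -/

theorem hasDerivAt_eval_zero (p : MvPolynomial (Fin 2) ℝ) (x y : ℝ) :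
    HasDerivAt (fun t ↦ eval ![t, y] p) (eval ![x, y] (pderiv 0 p)) x := by
  induction p using MvPolynomial.induction_on with
  | C a => simpa using hasDerivAt_const x a
  | add p q hp hq =>
    simp only [map_add]
    exact hp.add hq
  | mul_X p i hp =>
    have hX : HasDerivAt (fun t ↦ eval ![t, y] (X i : MvPolynomial (Fin 2) ℝ))
        (eval ![x, y] (pderiv 0 (X i : MvPolynomial (Fin 2) ℝ))) x := by
      fin_cases i
      · simpa using hasDerivAt_id' x
      · simpa [pderiv_X_of_ne] using hasDerivAt_const x y
    simp only [map_mul]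
    refine (hp.mul hX).congr_deriv ?_
    simp only [Derivation.leibniz, smul_eq_mul, map_add, map_mul]
    ring

theorem hasDerivAt_eval_one (p : MvPolynomial (Fin 2) ℝ) (x y : ℝ) :
    HasDerivAt (fun t ↦ eval ![x, t] p) (eval ![x, y] (pderiv 1 p)) y := by
  induction p using MvPolynomial.induction_on with
  | C a => simpa using hasDerivAt_const y a
  | add p q hp hq =>
    simp only [map_add]
    exact hp.add hq
  | mul_X p i hp =>
    have hX : HasDerivAt (fun t ↦ eval ![x, t] (X i : MvPolynomial (Fin 2) ℝ))
        (eval ![x, y] (pderiv 1 (X i : MvPolynomial (Fin 2) ℝ))) y := by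
      fin_cases i
      · simpa [pderiv_X_of_ne] using hasDerivAt_const y x
      · simpa using hasDerivAt_id' y
    simp only [map_mul]
    refine (hp.mul hX).congr_deriv ?_
    simp only [Derivation.leibniz, smul_eq_mul, map_add, map_mul]
    ring

theorem pderiv_pderiv_comm (p : MvPolynomial (Fin 2) ℝ) :
    pderiv 0 (pderiv 1 p) = pderiv 1 (pderiv 0 p) := by
  ext d
  rw [coeff_pderiv, coeff_pderiv, coeff_pderiv, coeff_pderiv, add_right_comm]
  simp
  ring

theorem continuous_eval_pair (p : MvPolynomial (Fin 2) ℝ) {α : Type*} [TopologicalSpace α]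
    {f g : α → ℝ} (hf : Continuous f) (hg : Continuous g) :
    Continuous fun a ↦ eval ![f a, g a] p := by
  refine (MvPolynomial.continuous_eval p).comp (continuous_pi fun i ↦ ?_)
  fin_cases i
  · simpa using hf
  · simpa using hg

/-- The phase in the variable `u = α x`. -/
theorem HasHessian.isMixedPhase {S : MvPolynomial (Fin 2) ℝ} {n β : ℕ} {c α : ℝ}
    (h : HasHessian S n β c α) (hα : α ≠ 0) :
    IsMixedPhase β (n - 2 - β) (α⁻¹ * c) (fun u y ↦ eval ![α⁻¹ * u, y] S)
      (fun u y ↦ α⁻¹ * eval ![α⁻¹ * u, y] (pderiv 0 S))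
      (fun u y ↦ α⁻¹ * (α⁻¹ * eval ![α⁻¹ * u, y] (pderiv 0 (pderiv 0 S)))) := by
  have hu : ∀ (p : MvPolynomial (Fin 2) ℝ) (u y : ℝ), HasDerivAt (fun u ↦ eval ![α⁻¹ * u, y] p)
      (α⁻¹ * eval ![α⁻¹ * u, y] (pderiv 0 p)) u := fun p u y ↦ by
    have h1 := (hasDerivAt_id u).const_mul α⁻¹
    have h2 := (hasDerivAt_eval_zero p (α⁻¹ * u) y).comp u h1
    exact h2.congr_deriv (by ring)
  have hαα : ∀ u : ℝ, α * (α⁻¹ * u) = u := fun u ↦ by field_simp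
  unfold HasHessian at h
  refine ⟨?_, hu S, fun u y ↦ (hu _ u y).const_mul _, fun y ↦ ?_, fun u y ↦ ?_, fun u y ↦ ?_⟩
  · exact continuous_eval_pair S (by fun_prop) (by fun_prop)
  · exact ((continuous_eval_pair _ (by fun_prop) (by fun_prop)).const_mul _).const_mul _
  · refine ((hasDerivAt_eval_one (pderiv 0 S) (α⁻¹ * u) y).const_mul _).congr_deriv ?_
    rw [← pderiv_pderiv_comm, h]
    simp [hαα]
    ring
  · refine (((hasDerivAt_eval_one (pderiv 0 (pderiv 0 S)) (α⁻¹ * u) y).const_mul _).const_mul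
      _).congr_deriv ?_
    rw [← pderiv_pderiv_comm, ← pderiv_pderiv_comm, h]
    simp [hαα, Derivation.leibniz_pow]
    field_simp

/-! ### The damped operator on test functions -/

theorem dampedKernel_eq_logKernel {S : MvPolynomial (Fin 2) ℝ} {n β : ℕ} {α : ℝ} (hα : α ≠ 0)
    (hβn : β < n - 2) (z : ℂ) {x y : ℝ} (hx : x ≠ 0) (hy : y - α * x ≠ 0) :
    dampedKernel S (dampingFactor n β α) z x y = Complex.exp (-(z * (Real.log α : ℂ))) *
      logKernel (fun u y ↦ eval ![α⁻¹ * u, y] S) (n - 2 - β) z (α * x) y := by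
  have hD : dampingFactor n β α x y ≠ 0 := mul_ne_zero hx (pow_ne_zero _ hy)
  have hlog : Real.log |dampingFactor n β α x y|
      = -Real.log α + logDamping (n - 2 - β) (α * x) y := by
    rw [Real.log_abs, dampingFactor, Real.log_mul hx (pow_ne_zero _ hy), Real.log_pow, logDamping,
      Real.log_mul hα hx]
    have : n - 2 - β = (n - 3 - β) + 1 := by omega
    rw [this]
    push_cast
    ring
  have hne : ((|dampingFactor n β α x y| : ℝ) : ℂ) ≠ 0 := by
    exact_mod_cast (abs_pos.2 hD).ne'
  have hα' : α⁻¹ * (α * x) = x := by field_simp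
  rw [dampedKernel, Complex.cpow_def_of_ne_zero hne, ← Complex.ofReal_log (abs_nonneg _), hlog,
    logKernel, hα', ← Complex.exp_add, ← Complex.exp_add]
  congr 1
  push_cast
  ring

theorem dampedOp_eq_integral_logKernel {S : MvPolynomial (Fin 2) ℝ} {n β : ℕ} {α : ℝ} (hα : α ≠ 0)
    (hβn : β < n - 2) (z : ℂ) (f : ℝ → ℂ) {x : ℝ} (hx : x ≠ 0) :
    dampedOp S (dampingFactor n β α) z f x = Complex.exp (-(z * (Real.log α : ℂ))) *
      ∫ y, logKernel (fun u y ↦ eval ![α⁻¹ * u, y] S) (n - 2 - β) z (α * x) y * f y := by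
  rw [dampedOp, ← integral_const_mul]
  refine integral_congr_ae ?_
  filter_upwards [Measure.ae_ne volume (α * x)] with y hy
  rw [dampedKernel_eq_logKernel hα hβn z hx (sub_ne_zero.2 hy), mul_assoc]

theorem lintegral_comp_mul_left_eq {α : ℝ} (hα : α ≠ 0) (g : ℝ → ℝ≥0∞) :
    ∫⁻ x, g (α * x) = ENNReal.ofReal |α⁻¹| * ∫⁻ u, g u := by
  rw [← smul_eq_mul, ← lintegral_smul_measure, ← Real.map_volume_mul_left hα]
  exact ((Homeomorph.mulLeft₀ α hα).measurableEmbedding.lintegral_map g).symm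

theorem two_mul_criticalExponent {n β : ℕ} (hβn : β < n - 2) :
    2 * criticalExponent n β
      = (((n - 2 - β : ℕ) : ℝ) - β) / (((β : ℝ) + 1) * ((n - 2 - β : ℕ) : ℝ)) := by
  have h1 : ((n - 2 - β : ℕ) : ℝ) = (n : ℝ) - β - 2 := by
    rw [Nat.cast_sub (by omega), Nat.cast_sub (by omega)]; push_cast; ring
  have h2 : (0 : ℝ) < (n : ℝ) - β - 2 := by
    rw [← h1]; exact_mod_cast (by omega : 0 < n - 2 - β)
  rw [criticalExponent, h1]
  field_simp
  ring

theorem measurable_dampedKernel (S : MvPolynomial (Fin 2) ℝ) {D : ℝ → ℝ → ℝ}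
    (hD : Measurable (Function.uncurry D)) (z : ℂ) :
    Measurable (Function.uncurry (dampedKernel S D z)) := by
  have h1 : Measurable fun p : ℝ × ℝ ↦ eval ![p.1, p.2] S :=
    (continuous_eval_pair S continuous_fst continuous_snd).measurable
  have h2 : Measurable fun p : ℝ × ℝ ↦ D p.1 p.2 := hD
  have h3 : Measurable fun p : ℝ × ℝ ↦ ((|D p.1 p.2| : ℝ) : ℂ) :=
    Complex.measurable_ofReal.comp h2.abs
  have h4 : Measurable fun p : ℝ × ℝ ↦ ((eval ![p.1, p.2] S : ℝ) : ℂ) :=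
    Complex.measurable_ofReal.comp h1
  exact (Complex.measurable_exp.comp (h4.const_mul _)).mul (h3.pow_const z)

theorem measurable_dampingFactor (n β : ℕ) (α : ℝ) :
    Measurable (Function.uncurry (dampingFactor n β α)) := by
  simp only [dampingFactor, Function.uncurry_def]
  fun_prop

theorem measurable_dampedOp (S : MvPolynomial (Fin 2) ℝ) {D : ℝ → ℝ → ℝ}
    (hD : Measurable (Function.uncurry D)) (z : ℂ) {f : ℝ → ℂ} (hf : Measurable f) :
    Measurable (dampedOp S D z f) := by
  have h := (measurable_dampedKernel S hD z).mul (hf.comp measurable_snd)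
  exact h.stronglyMeasurable.integral_prod_right'.measurable

/-- At the critical exponent, `|v| ^ ((m - 1) a)` is locally integrable. -/
theorem neg_sub_one_mul_lt_one {β m a : ℝ} (hβ : 0 ≤ β) (hm : 1 ≤ m)
    (ha : 2 * a = (m - β) / ((β + 1) * m)) : -((m - 1) * a) < 1 := by
  have h1 : 2 * a * ((β + 1) * m) = m - β := by rw [ha]; field_simp
  have h2 : 0 < (β + 1) * m := by positivity
  have h3 : 0 < (2 * (m - 1) * a + 2) * ((β + 1) * m) := by
    have : (2 * (m - 1) * a + 2) * ((β + 1) * m) = m ^ 2 + m + β * m + β := by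
      linear_combination (m - 1) * h1
    rw [this]; positivity
  have := pos_of_mul_pos_left h3 h2.le
  linarith

theorem locallyIntegrable_dampedKernel_add {S : MvPolynomial (Fin 2) ℝ} {n β : ℕ} {α : ℝ}
    (hα : α ≠ 0) (hβn : β < n - 2) {z : ℂ} (hz : z.re = criticalExponent n β) {x : ℝ}
    (hx : x ≠ 0) :
    LocallyIntegrable fun v ↦ dampedKernel S (dampingFactor n β α) z x (v + α * x) := by
  have hexp := neg_sub_one_mul_lt_one (Nat.cast_nonneg β)
    (by exact_mod_cast (by omega : 1 ≤ n - 2 - β)) (two_mul_criticalExponent hβn)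
  have hFm : Measurable fun v ↦ dampedKernel S (dampingFactor n β α) z x (v + α * x) :=
    (Measurable.of_uncurry_left (x := x)
      (measurable_dampedKernel S (measurable_dampingFactor n β α) z)).comp
      (measurable_add_const (α * x))
  refine locallyIntegrable_of_norm_le_rpow (E := ℝ) (by rw [Module.finrank_self])
    (C := ‖Complex.exp (-(z * (Real.log α : ℂ)))‖
      * Real.exp (criticalExponent n β * Real.log (α * x)))
    (α := -((((n - 2 - β : ℕ) : ℝ) - 1) * criticalExponent n β))
    (by rw [Module.finrank_self, Nat.cast_one]; exact hexp) ?_ hFm.aestronglyMeasurable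
  filter_upwards [Measure.ae_ne volume 0] with v hv
  have hv' : v + α * x - α * x = v := by ring
  rw [dampedKernel_eq_logKernel hα hβn z hx (by rwa [hv']), norm_mul, norm_logKernel, logDamping,
    hv', hz, mul_assoc, neg_neg, Real.norm_eq_abs, Real.rpow_def_of_pos (abs_pos.2 hv),
    Real.log_abs, ← Real.exp_add]
  apply le_of_eq
  congr 2
  ring

theorem integrable_dampedKernel_mul {S : MvPolynomial (Fin 2) ℝ} {n β : ℕ} {α : ℝ} (hα : α ≠ 0)
    (hβn : β < n - 2) {z : ℂ} (hz : z.re = criticalExponent n β) {f : ℝ → ℂ} (hf : Continuous f)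
    (hfc : HasCompactSupport f) {x : ℝ} (hx : x ≠ 0) :
    Integrable fun y ↦ dampedKernel S (dampingFactor n β α) z x y * f y := by
  have hfs : HasCompactSupport fun v ↦ f (v + α * x) :=
    hfc.comp_homeomorph (Homeomorph.addRight (α * x))
  have hfcont : Continuous fun v ↦ f (v + α * x) := hf.comp (continuous_add_const (α * x))
  have hi := ((locallyIntegrable_dampedKernel_add (S := S) hα hβn hz
    hx).integrable_smul_left_of_hasCompactSupport hfcont hfs).comp_sub_right (α * x)
  refine hi.congr (Filter.Eventually.of_forall fun y ↦ ?_)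
  simp only [sub_add_cancel, smul_eq_mul, mul_comm]

theorem exists_lintegral_dampedOp_sq_le {S : MvPolynomial (Fin 2) ℝ} {n β : ℕ} {c α : ℝ}
    (hβ : 0 < β) (hβn : β < n - 2) (hc : c ≠ 0) (hα : α ≠ 0) (h : HasHessian S n β c α) :
    ∃ A : ℝ, 0 ≤ A ∧ ∀ z : ℂ, z.re = criticalExponent n β → ∀ f : ℝ → ℂ, Continuous f →
      HasCompactSupport f → ∫⁻ x, ‖dampedOp S (dampingFactor n β α) z f x‖ₑ ^ 2
        ≤ ENNReal.ofReal (A * (1 + ‖z‖)) * ∫⁻ y, ‖f y‖ₑ ^ 2 := by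
  obtain ⟨A, hA0, hA⟩ := (h.isMixedPhase hα).exists_lintegral_sq_le
    (mul_ne_zero (inv_ne_zero hα) hc) hβ (by omega) (two_mul_criticalExponent hβn)
  set a := criticalExponent n β
  set C : ℝ := Real.exp (-(a * Real.log α)) ^ 2 * |α⁻¹| with hC
  refine ⟨C * A, by positivity, fun z hz f hf hfc ↦ ?_⟩
  obtain ⟨Mf, hMf⟩ := hf.bounded_above_of_compact_support hfc
  have hnorm : ‖Complex.exp (-(z * (Real.log α : ℂ)))‖ₑ
      = ENNReal.ofReal (Real.exp (-(a * Real.log α))) := by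
    rw [← ofReal_norm, Complex.norm_exp]
    simp [hz]
  have hae : ∀ᵐ x : ℝ, ‖dampedOp S (dampingFactor n β α) z f x‖ₑ ^ 2
      = ENNReal.ofReal (Real.exp (-(a * Real.log α))) ^ 2 * ‖∫ y, logKernel
        (fun u y ↦ eval ![α⁻¹ * u, y] S) (n - 2 - β) z (α * x) y * f y‖ₑ ^ 2 := by
    filter_upwards [Measure.ae_ne volume 0] with x hx
    rw [dampedOp_eq_integral_logKernel hα hβn z f hx, enorm_mul, mul_pow, hnorm]
  rw [lintegral_congr_ae hae, lintegral_const_mul' _ _ (by simp),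
    lintegral_comp_mul_left_eq hα fun u ↦ ‖∫ y, logKernel
        (fun u y ↦ eval ![α⁻¹ * u, y] S) (n - 2 - β) z u y * f y‖ₑ ^ 2]
  calc _ ≤ ENNReal.ofReal (Real.exp (-(a * Real.log α))) ^ 2 * (ENNReal.ofReal |α⁻¹| *
        (ENNReal.ofReal (A * (1 + ‖z‖)) * ∫⁻ y, ‖f y‖ₑ ^ 2)) := by
        gcongr
        exact hA z hz f hf.measurable ⟨Mf, hMf⟩
    _ = _ := by
      rw [← mul_assoc, ← mul_assoc, hC, mul_assoc _ A,
        ENNReal.ofReal_mul (q := A * (1 + ‖z‖)) (by positivity),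
        ENNReal.ofReal_mul (q := |α⁻¹|) (by positivity), ENNReal.ofReal_pow (by positivity)]

/-! ### Extension to `L²` -/

/-- The space `C_0^∞(ℝ)` of smooth compactly supported functions. -/
def testFunctions : Submodule ℂ (ℝ → ℂ) where
  carrier := {f | ContDiff ℝ ∞ f ∧ HasCompactSupport f}
  zero_mem' := ⟨contDiff_const, HasCompactSupport.zero⟩
  add_mem' hf hg := ⟨hf.1.add hg.1, hf.2.add hg.2⟩
  smul_mem' a _ hf := ⟨contDiff_const.mul hf.1, hf.2.mul_left (f := fun _ ↦ a)⟩

theorem testFunctions.memLp (f : testFunctions) : MemLp (f : ℝ → ℂ) 2 (volume : Measure ℝ) :=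
  f.2.1.continuous.memLp_of_hasCompactSupport f.2.2

/-- The inclusion of `C_0^∞(ℝ)` into `L²(ℝ)`. -/
noncomputable def testFunctionsToLp : testFunctions →ₗ[ℂ] Lp ℂ 2 (volume : Measure ℝ) where
  toFun f := (testFunctions.memLp f).toLp (f : ℝ → ℂ)
  map_add' f g := MemLp.toLp_add (testFunctions.memLp f) (testFunctions.memLp g)
  map_smul' a f := MemLp.toLp_const_smul a (testFunctions.memLp f)

theorem testFunctionsToLp_apply (f : testFunctions) :
    testFunctionsToLp f = (testFunctions.memLp f).toLp (f : ℝ → ℂ) := rfl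

theorem denseRange_testFunctionsToLp : DenseRange testFunctionsToLp := by
  refine (Lp.dense_hasCompactSupport_contDiff (E := ℝ) (F := ℂ) (p := 2) (μ := volume)
    (by norm_num)).mono ?_
  rintro f ⟨g, hfg, hgc, hgd⟩
  refine ⟨⟨g, hgd, hgc⟩, ?_⟩
  rw [testFunctionsToLp_apply]
  exact Lp.ext ((MemLp.coeFn_toLp (testFunctions.memLp ⟨g, hgd, hgc⟩)).trans hfg.symm)

theorem eLpNorm_two_eq_lintegral {f : ℝ → ℂ} :
    eLpNorm f 2 volume = (∫⁻ x, ‖f x‖ₑ ^ 2) ^ (1 / 2 : ℝ) := by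
  rw [eLpNorm_eq_lintegral_rpow_enorm_toReal (by norm_num) (by norm_num)]
  simp

/-- The integrability hypothesis makes the damped operator additive on test functions, almost
everywhere. -/
theorem exists_extendsDampedOp {S : MvPolynomial (Fin 2) ℝ} {D : ℝ → ℝ → ℝ}
    (hD : Measurable (Function.uncurry D)) {z : ℂ} {B : ℝ} (hB : 0 ≤ B)
    (hint : ∀ f : ℝ → ℂ, ContDiff ℝ ∞ f → HasCompactSupport f →
      ∀ᵐ x : ℝ, Integrable fun y ↦ dampedKernel S D z x y * f y)
    (hbound : ∀ f : ℝ → ℂ, Continuous f → HasCompactSupport f →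
      ∫⁻ x, ‖dampedOp S D z f x‖ₑ ^ 2 ≤ ENNReal.ofReal B * ∫⁻ y, ‖f y‖ₑ ^ 2) :
    ∃ T : Lp ℂ 2 (volume : Measure ℝ) →L[ℂ] Lp ℂ 2 (volume : Measure ℝ),
      ExtendsDampedOp S D z T ∧ ‖T‖ ≤ √B := by
  have hnorm : ∀ f : testFunctions, eLpNorm (dampedOp S D z f) 2 volume
      ≤ ENNReal.ofReal (√B) * eLpNorm (f : ℝ → ℂ) 2 volume := fun f ↦ by
    rw [eLpNorm_two_eq_lintegral, eLpNorm_two_eq_lintegral, Real.sqrt_eq_rpow,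
      ← ENNReal.ofReal_rpow_of_nonneg hB (by norm_num),
      ← ENNReal.mul_rpow_of_nonneg _ _ (by norm_num)]
    exact ENNReal.rpow_le_rpow (hbound f f.2.1.continuous f.2.2) (by norm_num)
  have hmem : ∀ f : testFunctions, MemLp (dampedOp S D z f) 2 volume := fun f ↦
    ⟨(measurable_dampedOp S hD z f.2.1.continuous.measurable).aestronglyMeasurable,
      (hnorm f).trans_lt (ENNReal.mul_lt_top ENNReal.ofReal_lt_top (testFunctions.memLp f).2)⟩
  obtain ⟨T₀, hT₀e⟩ : ∃ T₀ : testFunctions →ₗ[ℂ] Lp ℂ 2 (volume : Measure ℝ),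
      ∀ f, T₀ f = (hmem f).toLp _ := by
    refine ⟨{ toFun := fun f ↦ (hmem f).toLp _, map_add' := fun f g ↦ ?_,
              map_smul' := fun a f ↦ ?_ }, fun f ↦ rfl⟩
    · rw [← MemLp.toLp_add (hmem f) (hmem g)]
      refine MemLp.toLp_congr _ _ ?_
      filter_upwards [hint f f.2.1 f.2.2, hint g g.2.1 g.2.2] with x hf hg
      simp only [dampedOp, Pi.add_apply, Submodule.coe_add, mul_add]
      exact integral_add hf hg
    · rw [RingHom.id_apply, ← MemLp.toLp_const_smul a (hmem f)]
      refine MemLp.toLp_congr _ _ (Filter.Eventually.of_forall fun x ↦ ?_)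
      simp only [dampedOp, Pi.smul_apply, Submodule.coe_smul, smul_eq_mul]
      rw [← integral_const_mul]
      congr 1 with y
      ring
  have hT₀ : ∀ f, ‖T₀ f‖ ≤ √B * ‖testFunctionsToLp f‖ := fun f ↦ by
    rw [hT₀e, testFunctionsToLp_apply, Lp.norm_toLp, Lp.norm_toLp]
    refine (ENNReal.toReal_mono (ENNReal.mul_ne_top ENNReal.ofReal_ne_top
      (testFunctions.memLp f).2.ne) (hnorm f)).trans_eq ?_
    rw [ENNReal.toReal_mul, ENNReal.toReal_ofReal (Real.sqrt_nonneg _)]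
  refine ⟨T₀.extendOfNorm testFunctionsToLp, fun f hf hfc ↦ ?_,
    LinearMap.opNorm_extendOfNorm_le denseRange_testFunctionsToLp (Real.sqrt_nonneg _) hT₀⟩
  have h := LinearMap.extendOfNorm_eq denseRange_testFunctionsToLp ⟨√B, hT₀⟩ ⟨f, hf, hfc⟩
  rw [hT₀e, testFunctionsToLp_apply] at h
  rw [h]
  exact (hmem ⟨f, hf, hfc⟩).coeFn_toLp

/-! ### Unboundedness for `β = 0` -/

theorem isHomogeneous_X_sub_X_pow (n : ℕ) :
    ((X 0 - X 1) ^ n : MvPolynomial (Fin 2) ℝ).IsHomogeneous n := by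
  simpa using ((isHomogeneous_X ℝ (0 : Fin 2)).sub (isHomogeneous_X ℝ (1 : Fin 2))).pow n

theorem exists_hasHessian_X_sub_X_pow {n : ℕ} (hn : 3 ≤ n) :
    ∃ c : ℝ, c ≠ 0 ∧ HasHessian ((X 0 - X 1) ^ n) n 0 c 1 := by
  obtain ⟨k, rfl⟩ : ∃ k, n = k + 2 := ⟨n - 2, by omega⟩
  refine ⟨-((k + 2) * (k + 1) * (-1) ^ k), ?_, ?_⟩
  · have : ((k : ℝ) + 2) * (k + 1) ≠ 0 := by positivity
    exact neg_ne_zero.2 (mul_ne_zero this (pow_ne_zero _ (by norm_num)))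
  · have h1 : (X 1 - X 0 : MvPolynomial (Fin 2) ℝ) = -1 * (X 0 - X 1) := by ring
    have h2 : ((-1 : MvPolynomial (Fin 2) ℝ) ^ k) * (-1) ^ k = 1 := by
      rw [← mul_pow]; simp
    have e : k + 2 - 1 = k + 1 := by omega
    rw [HasHessian]
    simp only [Derivation.leibniz_pow, map_sub, pderiv_X_self, e, smul_eq_mul,
      Derivation.leibniz, nsmul_eq_mul, pderiv_X_of_ne (show (0 : Fin 2) ≠ 1 by decide),
      pderiv_X_of_ne (show (1 : Fin 2) ≠ 0 by decide), Nat.add_sub_cancel, pow_zero, one_mul,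
      Nat.sub_zero, h1, mul_pow, map_neg, map_mul, map_add, map_pow, map_natCast, map_one,
      map_ofNat, mul_one, Derivation.map_natCast, Derivation.map_one_eq_zero, map_zero]
    push_cast
    linear_combination ((k : MvPolynomial (Fin 2) ℝ) + 2) * (k + 1) * (X 0 - X 1) ^ k * h2

/-- The function `κ (u) = exp (i u ^ n) |u ^ (n - 3)| ^ (1 / 2)` for which the damped kernel of
`(x - y) ^ n` is `|x| ^ (1 / 2) κ (x - y)`. -/
noncomputable def translationKernel (n : ℕ) (u : ℝ) : ℂ :=
  Complex.exp (Complex.I * ((u ^ n : ℝ) : ℂ)) * ((√(|u ^ (n - 3)|) : ℝ) : ℂ)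

theorem continuous_translationKernel (n : ℕ) : Continuous (translationKernel n) := by
  unfold translationKernel
  fun_prop

theorem dampedKernel_X_sub_X_pow (n : ℕ) (x y : ℝ) :
    dampedKernel ((X 0 - X 1) ^ n) (dampingFactor n 0 1) (1 / 2) x y
      = ((√|x| : ℝ) : ℂ) * translationKernel n (x - y) := by
  have h1 : ((|dampingFactor n 0 1 x y| : ℝ) : ℂ) ^ (1 / 2 : ℂ)
      = ((√|x| : ℝ) : ℂ) * ((√(|(x - y) ^ (n - 3)|) : ℝ) : ℂ) := by
    have h2 : ((1 / 2 : ℝ) : ℂ) = 1 / 2 := by push_cast; rfl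
    rw [← h2, ← Complex.ofReal_cpow (abs_nonneg _), ← Real.sqrt_eq_rpow, dampingFactor, abs_mul,
      Real.sqrt_mul (abs_nonneg _), one_mul, Nat.sub_zero, abs_pow, abs_pow, abs_sub_comm y x]
    push_cast; rfl
  rw [dampedKernel, h1, translationKernel]
  simp
  ring

theorem exists_translationKernel_integral_ne_zero (n : ℕ) :
    ∃ f : ℝ → ℂ, ContDiff ℝ ∞ f ∧ HasCompactSupport f ∧
      ∫ y, f y * translationKernel n (0 - y) ≠ 0 := by
  by_contra! hcon
  have hk : Continuous fun y ↦ translationKernel n (0 - y) :=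
    (continuous_translationKernel n).comp (by fun_prop)
  have h0 := ae_eq_zero_of_integral_contDiff_smul_eq_zero hk.locallyIntegrable
    fun g hg hgc ↦ by
      have := hcon (fun y ↦ (g y : ℂ)) (Complex.ofRealCLM.contDiff.comp hg)
        (hgc.comp_left Complex.ofReal_zero)
      simpa using this
  have h1 := Continuous.ae_eq_iff_eq volume hk (continuous_const (y := (0 : ℂ))) |>.1 h0
  have h2 := congrFun h1 (-1)
  simp [translationKernel] at h2

/-- The translates `f (y - h)` of a test function are mapped to `|x| ^ (1 / 2) g (x - h)` with a
fixed continuous `g ≠ 0`, and the `L²` norm of these functions tends to infinity with `h`. -/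
theorem not_exists_extendsDampedOp_X_sub_X_pow (n : ℕ) :
    ¬ ∃ T : Lp ℂ 2 (volume : Measure ℝ) →L[ℂ] Lp ℂ 2 (volume : Measure ℝ),
      ExtendsDampedOp ((X 0 - X 1) ^ n) (dampingFactor n 0 1) (1 / 2) T := by
  rintro ⟨T, hT⟩
  obtain ⟨f, hf, hfc, hf0⟩ := exists_translationKernel_integral_ne_zero n
  set g : ℝ → ℂ := fun x ↦ ∫ y, f y * translationKernel n (x - y) with hg
  have hgc : Continuous g :=
    hfc.continuous_convolution_left (ContinuousLinearMap.mul ℝ ℂ) hf.continuous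
      (continuous_translationKernel n).locallyIntegrable
  set c₀ : ℝ≥0∞ := ∫⁻ x in Set.Ioo (-1 : ℝ) 1, ‖g x‖ₑ ^ 2 with hc₀
  have hc₀0 : c₀ ≠ 0 := fun h ↦ by
    rw [hc₀, lintegral_eq_zero_iff (hgc.measurable.enorm.pow_const 2)] at h
    have h' : g =ᵐ[volume.restrict (Set.Ioo (-1 : ℝ) 1)] fun _ ↦ 0 := by
      filter_upwards [h] with x hx
      simpa using hx
    have := Measure.eqOn_open_of_ae_eq h' isOpen_Ioo hgc.continuousOn continuousOn_const
      (by constructor <;> norm_num : (0 : ℝ) ∈ Set.Ioo (-1 : ℝ) 1)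
    exact hf0 this
  have hop : ∀ h x, dampedOp ((X 0 - X 1) ^ n) (dampingFactor n 0 1) (1 / 2) (fun y ↦ f (y - h)) x
      = ((√|x| : ℝ) : ℂ) * g (x - h) := fun h x ↦ by
    simp only [dampedOp, dampedKernel_X_sub_X_pow, hg, mul_assoc]
    rw [integral_const_mul]
    congr 1
    rw [← integral_sub_right_eq_self (fun y ↦ f y * translationKernel n (x - h - y)) h]
    congr 1 with y
    rw [sub_sub_sub_cancel_right, mul_comm]
  have hlower : ∀ N : ℕ, N * c₀ ≤ ∫⁻ x, ‖dampedOp ((X 0 - X 1) ^ n) (dampingFactor n 0 1) (1 / 2)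
      (fun y ↦ f (y - (N + 1))) x‖ₑ ^ 2 := fun N ↦ by
    have h1 : ∫⁻ x, ‖dampedOp ((X 0 - X 1) ^ n) (dampingFactor n 0 1) (1 / 2)
        (fun y ↦ f (y - (N + 1))) x‖ₑ ^ 2 = ∫⁻ x, ENNReal.ofReal |x + (N + 1)| * ‖g x‖ₑ ^ 2 := by
      rw [← lintegral_sub_right_eq_self (fun x ↦ ENNReal.ofReal |x + (N + 1)| * ‖g x‖ₑ ^ 2)
        ((N : ℝ) + 1)]
      refine lintegral_congr fun x ↦ ?_
      rw [hop, enorm_mul, mul_pow, sub_add_cancel]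
      congr 1
      rw [← ofReal_norm, Complex.norm_real, Real.norm_eq_abs, ← ENNReal.ofReal_pow (abs_nonneg _),
        sq_abs, Real.sq_sqrt (abs_nonneg _)]
    rw [h1, hc₀, ← lintegral_const_mul _ (hgc.measurable.enorm.pow_const 2)]
    refine (setLIntegral_mono_ae' measurableSet_Ioo
      (Filter.Eventually.of_forall fun x hx ↦ ?_)).trans
      (setLIntegral_le_lintegral (Set.Ioo (-1 : ℝ) 1) _)
    gcongr
    rw [← ENNReal.ofReal_natCast]
    refine ENNReal.ofReal_le_ofReal (le_trans ?_ (le_abs_self _))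
    linarith [hx.1]
  set M : ℝ≥0∞ := ‖T‖ₑ * eLpNorm f 2 volume with hM
  have hMtop : M ≠ ⊤ := ENNReal.mul_ne_top enorm_ne_top
    (hf.continuous.memLp_of_hasCompactSupport (p := 2) (μ := volume) hfc).2.ne
  have hupper : ∀ h : ℝ, ∫⁻ x, ‖dampedOp ((X 0 - X 1) ^ n) (dampingFactor n 0 1) (1 / 2)
      (fun y ↦ f (y - h)) x‖ₑ ^ 2 ≤ M ^ 2 := fun h ↦ by
    have hfh : ContDiff ℝ ∞ fun y ↦ f (y - h) := hf.comp (contDiff_id.sub contDiff_const)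
    have hfhc : HasCompactSupport fun y ↦ f (y - h) := by
      simpa [sub_eq_add_neg] using! hfc.comp_homeomorph (Homeomorph.addRight (-h))
    have hTh := hT _ hfh hfhc
    have hmem := hfh.continuous.memLp_of_hasCompactSupport (p := 2) (μ := volume) hfhc
    have htr : eLpNorm (fun y ↦ f (y - h)) 2 volume = eLpNorm f 2 volume := by
      rw [eLpNorm_two_eq_lintegral, eLpNorm_two_eq_lintegral,
        lintegral_sub_right_eq_self (fun y ↦ ‖f y‖ₑ ^ 2) h]
    have h1 : eLpNorm (dampedOp ((X 0 - X 1) ^ n) (dampingFactor n 0 1) (1 / 2)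
        (fun y ↦ f (y - h))) 2 volume ≤ M := by
      rw [← eLpNorm_congr_ae hTh, ← Lp.enorm_def, hM, ← htr]
      refine (T.le_opENorm _).trans_eq ?_
      rw [Lp.enorm_toLp]
    rw [eLpNorm_two_eq_lintegral] at h1
    have h2 := pow_le_pow_left' h1 2
    rwa [← ENNReal.rpow_natCast, ← ENNReal.rpow_mul, Nat.cast_ofNat,
      div_mul_cancel₀ _ two_ne_zero, ENNReal.rpow_one] at h2
  obtain ⟨N, hN⟩ := ENNReal.exists_nat_mul_gt hc₀0 (ENNReal.pow_ne_top hMtop (n := 2))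
  exact absurd hN (not_lt.2 ((hlower N).trans (hupper _)))

end Estimates

/-! ### The bounds at the critical exponent -/

/-- The estimates give the bound `C (1 + |z|) ^ (1 / 2)`, which is at most `A (1 + |Im z|) ^ 2` on
the critical line. -/
theorem exists_extendsDampedOp_norm_le {n β : ℕ} {S : MvPolynomial (Fin 2) ℝ} {c α : ℝ}
    (hβ : 0 < β) (hβn : β < n - 2) (hc : c ≠ 0) (hα : α ≠ 0) (h : HasHessian S n β c α) :
    ∃ A : ℝ, ∀ z : ℂ, z.re = criticalExponent n β →
      ∃ T : Lp ℂ 2 (volume : Measure ℝ) →L[ℂ] Lp ℂ 2 (volume : Measure ℝ),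
        ExtendsDampedOp S (dampingFactor n β α) z T ∧ ‖T‖ ≤ A * (1 + |z.im|) ^ 2 := by
  obtain ⟨A, hA0, hA⟩ := exists_lintegral_dampedOp_sq_le hβ hβn hc hα h
  refine ⟨√(A * (1 + |criticalExponent n β|)), fun z hz ↦ ?_⟩
  obtain ⟨T, hT, hTn⟩ := exists_extendsDampedOp (S := S) (z := z)
    (measurable_dampingFactor n β α) (B := A * (1 + ‖z‖)) (by positivity)
    (fun f hf hfc ↦ (Measure.ae_ne volume 0).mono fun x hx ↦
      integrable_dampedKernel_mul hα hβn hz hf.continuous hfc hx)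
    (hA z hz)
  refine ⟨T, hT, hTn.trans ?_⟩
  have hnorm : ‖z‖ ≤ |criticalExponent n β| + |z.im| := by
    rw [← hz]; exact Complex.norm_le_abs_re_add_abs_im z
  have h1 : A * (1 + ‖z‖) ≤ A * (1 + |criticalExponent n β|) * ((1 + |z.im|) ^ 2) ^ 2 := by
    rw [mul_assoc]
    gcongr
    have h0 := abs_nonneg z.im
    have h2 : 1 + |z.im| ≤ ((1 + |z.im|) ^ 2) ^ 2 := by
      rw [← pow_mul]; exact le_self_pow₀ (by linarith) (by norm_num)
    calc 1 + ‖z‖ ≤ (1 + |criticalExponent n β|) * (1 + |z.im|) := by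
          nlinarith [mul_nonneg (abs_nonneg (criticalExponent n β)) h0]
      _ ≤ _ := by gcongr
  calc √(A * (1 + ‖z‖)) ≤ √(A * (1 + |criticalExponent n β|) * ((1 + |z.im|) ^ 2) ^ 2) :=
        Real.sqrt_le_sqrt h1
    _ = _ := by rw [Real.sqrt_mul (by positivity), Real.sqrt_sq (by positivity)]

theorem mainTheorem5 :
    (∀ (n β : ℕ) (S : MvPolynomial (Fin 2) ℝ) (c α : ℝ),
      3 ≤ n → S.IsHomogeneous n → 0 < β → β < n - 2 → c ≠ 0 → α ≠ 0 →
      HasHessian S n β c α →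
      (∀ (z : ℂ), z.re = criticalExponent n β →
        ∀ f : ℝ → ℂ, ContDiff ℝ ∞ f → HasCompactSupport f →
          ∀ᵐ x : ℝ, Integrable
            (fun y : ℝ => dampedKernel S (dampingFactor n β α) z x y * f y)) ∧
      ∃ A : ℝ, ∀ z : ℂ, z.re = criticalExponent n β →
        ∃ T : Lp ℂ 2 (volume : Measure ℝ) →L[ℂ] Lp ℂ 2 (volume : Measure ℝ),
          ExtendsDampedOp S (dampingFactor n β α) z T ∧ ‖T‖ ≤ A * (1 + |z.im|) ^ 2) ∧
    (∀ n : ℕ, 3 ≤ n →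
      ((X 0 - X 1) ^ n : MvPolynomial (Fin 2) ℝ).IsHomogeneous n ∧
      (∃ c : ℝ, c ≠ 0 ∧ HasHessian ((X 0 - X 1) ^ n) n 0 c 1) ∧
      criticalExponent n 0 = 1 / 2 ∧
      ¬ ∃ T : Lp ℂ 2 (volume : Measure ℝ) →L[ℂ] Lp ℂ 2 (volume : Measure ℝ),
          ExtendsDampedOp ((X 0 - X 1) ^ n) (dampingFactor n 0 1) (1 / 2) T) := by
  refine ⟨fun n β S c α _ _ hβ hβn hc hα h ↦ ⟨fun z hz f hf hfc ↦ ?_,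
    exists_extendsDampedOp_norm_le hβ hβn hc hα h⟩, fun n hn ↦ ⟨isHomogeneous_X_sub_X_pow n,
    exists_hasHessian_X_sub_X_pow hn, ?_, not_exists_extendsDampedOp_X_sub_X_pow n⟩⟩
  · exact (Measure.ae_ne volume 0).mono fun x hx ↦
      integrable_dampedKernel_mul hα hβn hz hf.continuous hfc hx
  · have h2 : (n : ℝ) - 2 ≠ 0 := by
      have : (3 : ℝ) ≤ n := by exact_mod_cast hn
      linarith
    simp [criticalExponent, h2]
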